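/- **Setting.** Let $f:\mathcal X\to[0,1]$ attain its maximum $f^*$ at $x^*$. A binary hierarchical partition of $\mathcal X$ is given: the root cell is $\mathcal P_{0,0}=\mathcal X$, every cell $\mathcal P_{h,i}$ $(0\le i<2^h)$ is the disjoint union of its children $\mathcal P_{h+1,2i},\mathcal P_{h+1,2i+1}$, and an arm $x_{h,i}\in\mathcal P_{h,i}$ is fixed in each cell. Let $\phi(h)=\nu_1\rho^h$ with $\nu_1>0$, $0<\rho<1$, and assume $f(x)\ge f^*-\phi(h)$ for all $x\in\mathcal P_{h,i}$ whenever $x^*\in\mathcal P_{h,i}$. Let $\mathcal N_h(\eta)$ be the number of cells of depth $h$ with $\sup_{\mathcal P_{h,i}}f\ge f^*-\eta$. Assume that the near-optimality dimension $\inf\{d'>0:\ \mathcal N_h(3\phi(h))\le C\phi(h)^{-d'}\ \forall h\ge 0\}$ (with $\inf\emptyset=\infty$) is at most $d$, where $0\le d<\infty$. **Feedback.** In round $t=1,2,\dots$ a node $(h_t,i_t)$ is chosen from the past $\mathcal F_{t-1}$, and a reward $r_t\in[0,1]$ with $|r_t-f(x_{h_t,i_t})|\le b/2$ ($b>0$)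 is observed, with $\mathbb E[r_t\mid\mathcal F_{t-1}]=f(x_{h_t,i_t})$ and $\varepsilon\le\operatorname{Var}(r_t\mid\mathcal F_{t-1})\le V_{\max}$, where $\varepsilon>0$. The cumulative regret is $R_n=\sum_{t=1}^n(f^*-r_t)$. **Algorithm (VHCT).** Let $\delta\in(0,1]$, $c=3$, $\tilde\delta(t)=\min\{1,\delta/(3t)\}$, $t^+=2^{\lfloor\log_2 t\rfloor+1}$ and $\ell_t=\log(1/\tilde\delta(t^+))$. For a node $(h,i)$ pulled $T\ge1$ times so far, with empirical mean $\hat\mu$ and empirical variance $\hat V$ of its rewards, put at time $t$ $$\mathtt{SE}=c\sqrt{\frac{2\hat V\ell_t}{T}}+\frac{3bc^2\ell_t}{T},\qquad U=\hat\mu+\phi(h)+\mathtt{SE},\qquad \tau=\Big(\hat V+\sqrt{\hat V^2+6b\phi(h)\hat V}+3b\phi(h)\Big)\frac{c^2\ell_t}{\phi(h)^2},$$ and $U=+\infty$ for a node without pulls. Initially the tree consists of the root and its two children. Put $B=U$ at leaves and $B=\min\{U,\max_{\text{children}}B\}$ at internal nodes. In round $t$ start at the root; while the current node is the root, or is internal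 with $T\ge\tau$, move to a child with the larger $B$ (ties are broken arbitrarily); pull the node at which this stops. If it is a leaf and now $T\ge\tau$ (with the updated statistics), add its two children to the tree. **Theorem.** For all $\nu_1,\rho,b,C,d$ as above and every $\kappa$ there is a constant $C_1\ge0$, depending only on $(\nu_1,\rho,b,C,d,\kappa)$, and for every $\varepsilon>0$ a constant $C_2\ge0$, depending only on these and $\varepsilon$, such that in every such setting with $V_{\max}\le\kappa\varepsilon$, for every $n\ge1$ and every $\delta\in(0,1]$, the regret of VHCT run with $\phi(h)=\nu_1\rho^h$ and $\delta$ satisfies, with probability at least $1-\delta$, $$R_n\le 2\sqrt{2n\log\tfrac{4n^2}{\delta}}+C_1V_{\max}^{\frac1{d+2}}n^{\frac{d+1}{d+2}}\Big(\log\tfrac n\delta\Big)^{\frac1{d+2}}+C_2\,n^{\frac{2d+1}{2d+4}}\log\tfrac n\delta .$$ If VHCT is run with $\delta=1/n$, then $R_n$ is integrable and $\mathbb E[R_n]$ is at most the same right-hand side with $\delta=1/n$. -/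

import Mathlib

open MeasureTheory ProbabilityTheory
open scoped ENNReal

noncomputable section

namespace VHCT

/-! ### Hierarchical partitions, smoothness, near-optimality dimension -/

/-- A node `(h, i)` of the infinite binary tree: depth `h` and position `i < 2 ^ h`
(positions are counted from `0`). -/
abbrev Node := ℕ × ℕ

def root : Node := (0, 0)

def leftChild (v : Node) : Node := (v.1 + 1, 2 * v.2)

def rightChild (v : Node) : Node := (v.1 + 1, 2 * v.2 + 1)

/-- A binary hierarchical partition of `X`, together with the arm `rep h i` that is evaluated
when the node `(h, i)` is pulled. -/
structure HierPartition (X : Type*) where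
  cell : ℕ → ℕ → Set X
  rep : ℕ → ℕ → X
  cell_root : cell 0 0 = Set.univ
  cell_split : ∀ h i, i < 2 ^ h → cell h i = cell (h + 1) (2 * i) ∪ cell (h + 1) (2 * i + 1)
  cell_disjoint : ∀ h i, i < 2 ^ h → Disjoint (cell (h + 1) (2 * i)) (cell (h + 1) (2 * i + 1))
  rep_mem : ∀ h i, i < 2 ^ h → rep h i ∈ cell h i

/-- The arm of a node. -/
def HierPartition.arm {X : Type*} (P : HierPartition X) (v : Node) : X := P.rep v.1 v.2

/-- Local smoothness at the maximizer `xstar`: on the cell of depth `h` that contains `xstar`,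
`f` is at most `φ h` below its maximum. -/
def LocallySmooth {X : Type*} (P : HierPartition X) (f : X → ℝ) (xstar : X) (φ : ℕ → ℝ) : Prop :=
  ∀ h i, i < 2 ^ h → xstar ∈ P.cell h i → ∀ x ∈ P.cell h i, f xstar - φ h ≤ f x

open Classical in
/-- The number of `η`-optimal cells of depth `h`, i.e. those with `sup f ≥ fstar - η`. -/
def nearOptCount {X : Type*} (P : HierPartition X) (f : X → ℝ) (fstar : ℝ) (h : ℕ) (η : ℝ) : ℕ :=
  ((Finset.range (2 ^ h)).filter (fun i => fstar - η ≤ sSup (f '' P.cell h i))).card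

/-- The near-optimality dimension `d(a, C, ξ)`: the infimum of the `d > 0` such that for every
depth `h` at most `C * ξ(h) ^ (-d)` cells are `a * ξ(h)`-optimal (`∞` if there is no such `d`). -/
def nearOptDim {X : Type*} (P : HierPartition X) (f : X → ℝ) (fstar a C : ℝ) (ξ : ℕ → ℝ) : ℝ≥0∞ :=
  ⨅ (d : ℝ) (_ : 0 < d ∧ ∀ h, (nearOptCount P f fstar h (a * ξ h) : ℝ) ≤ C * ξ h ^ (-d)),
    ENNReal.ofReal d

/-! ### Statistics of a trajectory

A trajectory consists of the pulled nodes `p 1, p 2, …` and the rewards `r 1, r 2, …`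
(index `0` is not used). -/

/-- The rounds among `1, …, m` in which the node `v` was pulled. -/
def pullTimes (p : ℕ → Node) (m : ℕ) (v : Node) : Finset ℕ :=
  (Finset.Icc 1 m).filter (fun s => p s = v)

/-- `T_v(m)`. -/
def pulls (p : ℕ → Node) (m : ℕ) (v : Node) : ℕ := (pullTimes p m v).card

/-- The empirical mean of the rewards of `v` after `m` rounds. -/
def empMean (p : ℕ → Node) (r : ℕ → ℝ) (m : ℕ) (v : Node) : ℝ :=
  (∑ s ∈ pullTimes p m v, r s) / pulls p m v

/-- The empirical variance of the rewards of `v` after `m` rounds. -/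
def empVar (p : ℕ → Node) (r : ℕ → ℝ) (m : ℕ) (v : Node) : ℝ :=
  (∑ s ∈ pullTimes p m v, (r s - empMean p r m v) ^ 2) / pulls p m v

/-- `t⁺ = 2 ^ (⌊log₂ t⌋ + 1)`. -/
def tPlus (t : ℕ) : ℕ := 2 ^ (Nat.log 2 t + 1)

/-- The confidence level `min {1, δ / (3 t)}`. -/
def deltaTilde (δ : ℝ) (t : ℕ) : ℝ := min 1 (δ / (3 * t))

/-- `log (1 / δ̃(t⁺))`. -/
def confLog (δ : ℝ) (t : ℕ) : ℝ := Real.log (1 / deltaTilde δ (tPlus t))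

/-- The empirical-Bernstein uncertainty quantifier (with `c = 3`) of `v`, computed at time `t`
from the statistics after `m` rounds:
`c √(2 V̂ log(1/δ̃(t⁺)) / T) + 3 b c² log(1/δ̃(t⁺)) / T`. -/
def statErr (b δ : ℝ) (p : ℕ → Node) (r : ℕ → ℝ) (m t : ℕ) (v : Node) : ℝ :=
  3 * √(2 * empVar p r m v * confLog δ t / pulls p m v)
    + 3 * b * 3 ^ 2 * confLog δ t / pulls p m v

/-- The upper confidence value `U = μ̂ + φ(h) + SE`; it is `+∞` for a node without pulls. -/
def uValue (φ : ℕ → ℝ) (b δ : ℝ) (p : ℕ → Node) (r : ℕ → ℝ) (m t : ℕ) (v : Node) : EReal :=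
  if pulls p m v = 0 then ⊤
  else ((empMean p r m v + φ v.1 + statErr b δ p r m t v : ℝ) : EReal)

/-- The threshold `τ`, i.e. the number of pulls at which the uncertainty quantifier equals `φ(h)`:
`τ = (V̂ + √(V̂² + 6 b φ V̂) + 3 b φ) c² log(1/δ̃(t⁺)) / φ²` with `c = 3`. -/
def threshold (φ : ℕ → ℝ) (b δ : ℝ) (p : ℕ → Node) (r : ℕ → ℝ) (m t : ℕ) (v : Node) : ℝ :=
  (empVar p r m v + √(empVar p r m v ^ 2 + 6 * b * φ v.1 * empVar p r m v) + 3 * b * φ v.1)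
    * (3 ^ 2 * confLog δ t / φ v.1 ^ 2)

/-! ### The tree -/

/-- The internal (already expanded) nodes after `m` rounds. At the start only the root is
expanded; at the end of round `t` the pulled node is expanded if `T ≥ τ`. -/
def expanded (φ : ℕ → ℝ) (b δ : ℝ) (p : ℕ → Node) (r : ℕ → ℝ) : ℕ → Finset Node
  | 0 => {root}
  | m + 1 =>
      open Classical in
      if threshold φ b δ p r (m + 1) (m + 1) (p (m + 1)) ≤ pulls p (m + 1) (p (m + 1)) then
        insert (p (m + 1)) (expanded φ b δ p r m)
      else expanded φ b δ p r m

/-- Auxiliary recursion for the backward values, cut off after a given number of levels. -/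
def bAux (E : Finset Node) (U : Node → EReal) : ℕ → Node → EReal
  | 0, v => U v
  | k + 1, v =>
      if v ∈ E then min (U v) (max (bAux E U k (leftChild v)) (bAux E U k (rightChild v)))
      else U v

/-- The backward value `B` for a tree with set of internal nodes `E`. It satisfies
`B = U` at leaves and `B = min {U, max over the two children of B}` at internal nodes: see
`bValue_leaf` and `bValue_internal`. -/
def bValue (E : Finset Node) (U : Node → EReal) (v : Node) : EReal := bAux E U E.card v

theorem bAux_leaf (E : Finset Node) (U : Node → EReal) (k : ℕ) {v : Node} (hv : v ∉ E) :
    bAux E U k v = U v := by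
  cases k <;> simp [bAux, hv]

theorem bAux_succ (E : Finset Node) (U : Node → EReal) (k : ℕ) :
    ∀ v : Node, (E.filter (fun w => v.1 ≤ w.1)).card ≤ k →
      bAux E U (k + 1) v = bAux E U k v := by
  induction k with
  | zero =>
    intro v hk
    have hv : v ∉ E := by
      intro hv
      have : v ∈ E.filter (fun w => v.1 ≤ w.1) := by simp [hv]
      have := Finset.card_pos.mpr ⟨v, this⟩
      omega
    rw [bAux_leaf E U _ hv, bAux_leaf E U _ hv]
  | succ k ih =>
    intro v hk
    by_cases hv : v ∈ E
    · have hlt : (E.filter (fun w => v.1 + 1 ≤ w.1)).card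
          < (E.filter (fun w => v.1 ≤ w.1)).card := by
        apply Finset.card_lt_card
        refine ⟨fun w hw => ?_, fun h => ?_⟩
        · simp only [Finset.mem_filter] at hw ⊢
          exact ⟨hw.1, by omega⟩
        · have : v ∈ E.filter (fun w => v.1 + 1 ≤ w.1) := h (by simp [hv])
          simp at this
      have hle := Nat.le_of_lt_succ (lt_of_lt_of_le hlt hk)
      have h1 := ih (leftChild v) (by convert hle; rfl)
      have h2 := ih (rightChild v) (by convert hle; rfl)
      rw [bAux, if_pos hv, h1, h2, bAux, if_pos hv]
    · rw [bAux_leaf E U _ hv, bAux_leaf E U _ hv]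

theorem bValue_leaf (E : Finset Node) (U : Node → EReal) {v : Node} (hv : v ∉ E) :
    bValue E U v = U v := bAux_leaf E U _ hv

theorem bValue_internal (E : Finset Node) (U : Node → EReal) {v : Node} (hv : v ∈ E) :
    bValue E U v = min (U v) (max (bValue E U (leftChild v)) (bValue E U (rightChild v))) := by
  have h := bAux_succ E U E.card v (Finset.card_filter_le _ _)
  rw [bValue, ← h, bAux, if_pos hv]
  rfl

/-! ### The algorithm -/

/-- The descent of round `m + 1` moves on from `v` to one of its children: `v` is an internal node
and has `T ≥ τ`, or it is the root (for which `T = τ = 1` by convention). -/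
def Passes (φ : ℕ → ℝ) (b δ : ℝ) (p : ℕ → Node) (r : ℕ → ℝ) (m : ℕ) (v : Node) : Prop :=
  v ∈ expanded φ b δ p r m ∧ (v = root ∨ threshold φ b δ p r m (m + 1) v ≤ pulls p m v)

/-- The backward value used in the descent of round `m + 1`. -/
def descentB (φ : ℕ → ℝ) (b δ : ℝ) (p : ℕ → Node) (r : ℕ → ℝ) (m : ℕ) (v : Node) : EReal :=
  bValue (expanded φ b δ p r m) (uValue φ b δ p r m (m + 1)) v

/-- The nodes on a greedy descent path of round `m + 1`: it starts at the root and goes from a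
node that is passed to a child with maximal backward value (ties are broken arbitrarily). -/
inductive Visited (φ : ℕ → ℝ) (b δ : ℝ) (p : ℕ → Node) (r : ℕ → ℝ) (m : ℕ) : Node → Prop
  | root : Visited φ b δ p r m root
  | left (v : Node) : Visited φ b δ p r m v → Passes φ b δ p r m v →
      descentB φ b δ p r m (rightChild v) ≤ descentB φ b δ p r m (leftChild v) →
      Visited φ b δ p r m (leftChild v)
  | right (v : Node) : Visited φ b δ p r m v → Passes φ b δ p r m v →
      descentB φ b δ p r m (leftChild v) ≤ descentB φ b δ p r m (rightChild v) →
      Visited φ b δ p r m (rightChild v)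

/-- `p` and `r` are the nodes and rewards of a run of VHCT with smoothness function `φ`, noise
range `b` and confidence parameter `δ`: in every round the pulled node is the end of a greedy
descent, i.e. the first node on it that is a leaf or has `T < τ`. -/
def IsRun (φ : ℕ → ℝ) (b δ : ℝ) (p : ℕ → Node) (r : ℕ → ℝ) : Prop :=
  ∀ m, Visited φ b δ p r m (p (m + 1)) ∧ ¬ Passes φ b δ p r m (p (m + 1))

/-- The random interaction of VHCT with a noisy objective `f`. The node of round `t + 1` is chosen
from the information `ℱ t` available after round `t`; its reward lies in `[0, 1]`, deviates from
`f` by at most `b / 2`, and has, conditionally on `ℱ t`, mean `f (x_{p (t + 1)})` and variance in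
`[ε, Vmax]`. -/
structure Interaction {X Ω : Type*} [MeasurableSpace Ω] (μ : Measure Ω) (ℱ : Filtration ℕ ‹_›)
    (P : HierPartition X) (f : X → ℝ) (φ : ℕ → ℝ) (b δ ε Vmax : ℝ)
    (p : ℕ → Ω → Node) (r : ℕ → Ω → ℝ) : Prop where
  node_meas : ∀ t, Measurable[ℱ t] (p (t + 1))
  reward_meas : ∀ t, Measurable[ℱ (t + 1)] (r (t + 1))
  reward_mem : ∀ t, ∀ᵐ ω ∂μ, r (t + 1) ω ∈ Set.Icc (0 : ℝ) 1
  noise_bdd : ∀ t, ∀ᵐ ω ∂μ, |r (t + 1) ω - f (P.arm (p (t + 1) ω))| ≤ b / 2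
  mean : ∀ t, μ[r (t + 1) | ℱ t] =ᵐ[μ] fun ω => f (P.arm (p (t + 1) ω))
  variance : ∀ t, ∀ᵐ ω ∂μ, (Var[r (t + 1); μ | ℱ t]) ω ∈ Set.Icc ε Vmax
  isRun : ∀ᵐ ω ∂μ, IsRun φ b δ (fun t => p t ω) (fun t => r t ω)

/-- The cumulative regret `R_n = ∑_{t = 1}^n (f* - r_t)`. -/
def regret {Ω : Type*} (fstar : ℝ) (r : ℕ → Ω → ℝ) (n : ℕ) (ω : Ω) : ℝ :=
  ∑ t ∈ Finset.Icc 1 n, (fstar - r t ω)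

/-- The right-hand side of the regret bound. -/
def regretBound (C₁ C₂ Vmax d δ : ℝ) (n : ℕ) : ℝ :=
  2 * √(2 * n * Real.log (4 * n ^ 2 / δ))
    + C₁ * Vmax ^ (1 / (d + 2)) * (n : ℝ) ^ ((d + 1) / (d + 2))
        * Real.log (n / δ) ^ (1 / (d + 2))
    + C₂ * (n : ℝ) ^ ((2 * d + 1) / (2 * d + 4)) * Real.log (n / δ)

end VHCT

end

noncomputable section
namespace VHCT

/-! ### Confidence levels -/

/-! The core is deterministic, on the event that `Concentrated` holds after every round m < n. There
the confidence values of all cells containing x* are at least f*, hence so are the backward values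
along the whole descent path. A non-root node that the descent passes has T ≥ τ, that is SE ≤ φ(h),
so its gap is at most φ + 2 SE ≤ 3φ(h); hence every pulled node has a 3φ-optimal parent, and
O(φ(h)^(-d)) nodes of depth h are ever pulled. A node that is pulled again has T < τ, that is SE >
φ(h), so its gap is at most 3 SE and its total regret is O(ℓ (V/φ(h) + b + 1)). Both facts are in
`node_regret`.

`pseudoRegret_le` cuts the tree where φ(h) = η. Shallow nodes are summed by depth and contribute ℓ V
η^(-(d+1)) to leading order. Deep nodes are charged to their parents: a passed parent has at least
of order εℓ/φ² pulls, because its empirical variance is bounded below, so by V ≤ κε the regret of a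
child is, to leading order, at most φ times the pulls of its parent. A parent has two children, so
this sums to O(nη). `exists_pseudoRegret_bound` balances the two parts by η^(d+2) = V log(n/δ)/n.

The concentration comes from exp(λX - λ²X²) ≤ 1 + λX for |λX| ≤ 1/4. It yields supermartingales that
do not involve the unknown variance; a grid of values of λ turns them into a deviation bound by the
sum of squares, which is then expressed through the empirical variance (`abs_sum_le_of_grid`,
`le_bernstein_of_le_sqrt`). Two further supermartingales control the sum of squares itself. A node
is identified by the round of its first pull, so the union bound runs over rounds and not over the
infinite tree. Azuma's inequality for the summed noise gives the first term of the regret bound. -/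

theorem two_le_tPlus (t : ℕ) : 2 ≤ tPlus t := by
  unfold tPlus
  rw [pow_succ]
  have : 1 ≤ 2 ^ Nat.log 2 t := Nat.one_le_two_pow
  omega

theorem lt_tPlus (t : ℕ) : t < tPlus t := Nat.lt_pow_succ_log_self (by norm_num) t

theorem tPlus_le {t : ℕ} (ht : 1 ≤ t) : tPlus t ≤ 2 * t := by
  unfold tPlus
  rw [pow_succ]
  have := Nat.pow_log_le_self 2 (x := t) (by omega)
  omega

theorem tPlus_mono {s t : ℕ} (h : s ≤ t) : tPlus s ≤ tPlus t :=
  Nat.pow_le_pow_right (by norm_num) (by have := Nat.log_mono_right (b := 2) h; omega)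

theorem confLog_eq {δ : ℝ} (h0 : 0 < δ) (h1 : δ ≤ 1) (t : ℕ) :
    confLog δ t = Real.log (3 * tPlus t / δ) := by
  have h2 : (2 : ℝ) ≤ tPlus t := by exact_mod_cast two_le_tPlus t
  unfold confLog deltaTilde
  rw [min_eq_right, one_div_div]
  rw [div_le_one (by positivity)]
  linarith

theorem one_le_confLog {δ : ℝ} (h0 : 0 < δ) (h1 : δ ≤ 1) (t : ℕ) : 1 ≤ confLog δ t := by
  have h2 : (2 : ℝ) ≤ tPlus t := by exact_mod_cast two_le_tPlus t
  rw [confLog_eq h0 h1, Real.le_log_iff_exp_le (by positivity), le_div_iff₀ h0]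
  have := Real.exp_one_lt_d9
  nlinarith [Real.exp_pos 1]

theorem confLog_mono {δ : ℝ} (h0 : 0 < δ) (h1 : δ ≤ 1) {s t : ℕ} (h : s ≤ t) :
    confLog δ s ≤ confLog δ t := by
  have h2 : (2 : ℝ) ≤ tPlus s := by exact_mod_cast two_le_tPlus s
  have h3 : (tPlus s : ℝ) ≤ tPlus t := by exact_mod_cast tPlus_mono h
  rw [confLog_eq h0 h1, confLog_eq h0 h1]
  gcongr

theorem confLog_le {δ : ℝ} (h0 : 0 < δ) (h1 : δ ≤ 1) {t n : ℕ} (ht : t ≤ n) (hn : 2 ≤ n) :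
    confLog δ t ≤ 4 * Real.log (n / δ) := by
  have hn' : (2 : ℝ) ≤ n := by exact_mod_cast hn
  have h2 : (2 : ℝ) ≤ tPlus n := by exact_mod_cast two_le_tPlus n
  have h3 : (tPlus n : ℝ) ≤ 2 * n := by exact_mod_cast tPlus_le (by omega : 1 ≤ n)
  refine (confLog_mono h0 h1 ht).trans ?_
  rw [confLog_eq h0 h1, show (4 : ℝ) * Real.log (n / δ) = Real.log ((n / δ) ^ 4) by
    rw [Real.log_pow]; norm_num]
  apply Real.log_le_log (by positivity)
  have hx : (2 : ℝ) ≤ n / δ := by rw [le_div_iff₀ h0]; nlinarith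
  have h4 : 3 * (tPlus n : ℝ) / δ ≤ 6 * (n / δ) := by
    rw [← mul_div_assoc]; exact div_le_div_of_nonneg_right (by linarith) h0.le
  have : (8 : ℝ) ≤ (n / δ) ^ 3 := by
    calc (8 : ℝ) = 2 ^ 3 := by norm_num
      _ ≤ _ := by gcongr
  nlinarith

/-! ### The threshold is the number of pulls at which the uncertainty equals `φ` -/

section Threshold

variable {φ b l T V : ℝ}

/-- With a = √(2V), y = √(9l/T) and s = √(a² + 12bφ), the left side is the quadratic inequality 3b
y² + a y ≤ φ, solved by 6b y + a ≤ s, or equivalently (a + s) y ≤ 2φ. The bracket in τ is ((a +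
s)/2)², so squaring gives the right side. -/
theorem bernstein_le_iff (hφ : 0 < φ) (hb : 0 < b) (hl : 0 < l) (hT : 0 < T) (hV : 0 ≤ V) :
    3 * √(2 * V * l / T) + 3 * b * 3 ^ 2 * l / T ≤ φ ↔
      (V + √(V ^ 2 + 6 * b * φ * V) + 3 * b * φ) * (3 ^ 2 * l / φ ^ 2) ≤ T := by
  obtain ⟨a, ha0, ha⟩ : ∃ a : ℝ, 0 ≤ a ∧ a ^ 2 = 2 * V :=
    ⟨√(2 * V), by positivity, Real.sq_sqrt (by positivity)⟩
  obtain ⟨s, hs0, hs⟩ : ∃ s : ℝ, 0 < s ∧ s ^ 2 = 2 * V + 12 * b * φ :=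
    ⟨√(2 * V + 12 * b * φ), by positivity, Real.sq_sqrt (by positivity)⟩
  obtain ⟨y, hy0, hy⟩ : ∃ y : ℝ, 0 < y ∧ y ^ 2 = 9 * l / T :=
    ⟨√(9 * l / T), by positivity, Real.sq_sqrt (by positivity)⟩
  have e1 : 3 * √(2 * V * l / T) = a * y := by
    rw [← Real.sqrt_sq (by positivity : 0 ≤ a * y), mul_pow, ha, hy,
      show 2 * V * (9 * l / T) = 3 ^ 2 * (2 * V * l / T) by ring,
      Real.sqrt_mul (by positivity), Real.sqrt_sq (by norm_num)]
  have e2 : √(V ^ 2 + 6 * b * φ * V) = s * a / 2 := by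
    rw [← Real.sqrt_sq (by positivity : 0 ≤ s * a / 2), div_pow, mul_pow, ha, hs]
    congr 1; ring
  have e3 : 3 * b * 3 ^ 2 * l / T = 3 * b * y ^ 2 := by rw [hy]; ring
  have e4 : V + s * a / 2 + 3 * b * φ = ((a + s) / 2) ^ 2 := by nlinarith
  have e5 : ((a + s) / 2) ^ 2 * (3 ^ 2 * l / φ ^ 2) ≤ T ↔ (a + s) * y ≤ 2 * φ := by
    rw [← abs_of_pos (by positivity : 0 < (a + s) * y), ← abs_of_pos (by positivity : 0 < 2 * φ),
      ← sq_le_sq, mul_pow, hy]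
    constructor
    · intro h
      rw [mul_div_assoc', div_le_iff₀ (by positivity)] at h
      rw [mul_div_assoc', div_le_iff₀ hT]
      nlinarith
    · intro h
      rw [mul_div_assoc', div_le_iff₀ hT] at h
      rw [mul_div_assoc', div_le_iff₀ (by positivity)]
      nlinarith
  rw [e1, e2, e3, e4, e5]
  have e6 : 12 * b * φ = (s - a) * (a + s) := by nlinarith
  have e7 : (a + s) * y ≤ 2 * φ ↔ 6 * b * y + a ≤ s := by
    constructor
    · intro h
      by_contra hc
      push Not at hc
      have : (s - a) * (a + s) < 6 * b * y * (a + s) := by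
        apply mul_lt_mul_of_pos_right _ (by positivity); linarith
      nlinarith
    · intro h
      have : 6 * b * y * (a + s) ≤ (s - a) * (a + s) := by
        apply mul_le_mul_of_nonneg_right _ (by positivity); linarith
      have : 6 * b * (y * (a + s)) ≤ 6 * b * (2 * φ) := by nlinarith
      have := le_of_mul_le_mul_left this (by positivity)
      linarith
  rw [e7]
  have e8 : 12 * b * (a * y + 3 * b * y ^ 2) = (6 * b * y + a) ^ 2 - a ^ 2 := by ring
  have e9 : a * y + 3 * b * y ^ 2 ≤ φ ↔ (6 * b * y + a) ^ 2 ≤ s ^ 2 := by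
    rw [← mul_le_mul_iff_right₀ (by positivity : 0 < 12 * b), e8]
    constructor <;> intro h <;> nlinarith
  rw [e9, sq_le_sq, abs_of_pos hs0, abs_of_pos (by positivity)]

end Threshold

theorem empVar_nonneg (p : ℕ → Node) (r : ℕ → ℝ) (m : ℕ) (v : Node) : 0 ≤ empVar p r m v := by
  unfold empVar; positivity

/-! ### Pathwise properties of a run -/

section Algorithm

variable {φ : ℕ → ℝ} {b δ : ℝ} {p : ℕ → Node} {r : ℕ → ℝ}

theorem statErr_le_iff (hφ : ∀ h, 0 < φ h) (hb : 0 < b) (h0 : 0 < δ) (h1 : δ ≤ 1) {m t : ℕ}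
    {v : Node} (hT : 0 < pulls p m v) :
    statErr b δ p r m t v ≤ φ v.1 ↔ threshold φ b δ p r m t v ≤ pulls p m v := by
  have hl : 0 < confLog δ t := lt_of_lt_of_le one_pos (one_le_confLog h0 h1 t)
  exact bernstein_le_iff (hφ _) hb hl (by exact_mod_cast hT) (empVar_nonneg p r m v)

/-- Both summands matter later: the one in b makes the variance correction b²ℓ/T small at a passed
node, the one in V̂ forces of order V̂ℓ/φ² pulls. -/
theorem le_threshold (hφ : ∀ h, 0 < φ h) (hb : 0 < b) (h0 : 0 < δ) (h1 : δ ≤ 1) (m t : ℕ)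
    (v : Node) :
    (2 * empVar p r m v + 3 * b * φ v.1) * (9 * confLog δ t / φ v.1 ^ 2)
      ≤ threshold φ b δ p r m t v := by
  have hl : 0 < confLog δ t := lt_of_lt_of_le one_pos (one_le_confLog h0 h1 t)
  have hV := empVar_nonneg p r m v
  have hφv := hφ v.1
  unfold threshold
  rw [show (3 : ℝ) ^ 2 = 9 by norm_num]
  gcongr
  have : empVar p r m v ≤ √(empVar p r m v ^ 2 + 6 * b * φ v.1 * empVar p r m v) := by
    apply Real.le_sqrt_of_sq_le
    have : 0 ≤ 6 * b * φ v.1 * empVar p r m v := by positivity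
    linarith
  linarith

theorem threshold_pos (hφ : ∀ h, 0 < φ h) (hb : 0 < b) (h0 : 0 < δ) (h1 : δ ≤ 1) (m t : ℕ)
    (v : Node) : 0 < threshold φ b δ p r m t v := by
  have hl : 0 < confLog δ t := lt_of_lt_of_le one_pos (one_le_confLog h0 h1 t)
  have hV := empVar_nonneg p r m v
  have hφv := hφ v.1
  exact lt_of_lt_of_le (by positivity) (le_threshold hφ hb h0 h1 m t v)

theorem pulls_pos_of_threshold_le (hφ : ∀ h, 0 < φ h) (hb : 0 < b) (h0 : 0 < δ) (h1 : δ ≤ 1)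
    {m t : ℕ} {v : Node} (h : threshold φ b δ p r m t v ≤ pulls p m v) : 0 < pulls p m v := by
  exact_mod_cast (threshold_pos hφ hb h0 h1 m t v).trans_le h

theorem threshold_mono (h0 : 0 < δ) (h1 : δ ≤ 1) (hb : 0 < b) (hφ : ∀ h, 0 < φ h)
    {m s t : ℕ} (hst : s ≤ t) (v : Node) :
    threshold φ b δ p r m s v ≤ threshold φ b δ p r m t v := by
  have hV := empVar_nonneg p r m v
  have hφv := hφ v.1
  have := confLog_mono h0 h1 hst
  unfold threshold
  gcongr

theorem mem_pullTimes {m s : ℕ} {v : Node} :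
    s ∈ pullTimes p m v ↔ (1 ≤ s ∧ s ≤ m) ∧ p s = v := by
  simp [pullTimes]

theorem pulls_mono {m n : ℕ} (h : m ≤ n) (v : Node) : pulls p m v ≤ pulls p n v := by
  apply Finset.card_le_card
  intro s
  simp only [mem_pullTimes]
  rintro ⟨⟨h1, h2⟩, h3⟩
  exact ⟨⟨h1, h2.trans h⟩, h3⟩

theorem root_mem_expanded (m : ℕ) : root ∈ expanded φ b δ p r m := by
  induction m with
  | zero => simp [expanded]
  | succ m ih => simp only [expanded]; split_ifs <;> simp [ih]

theorem expanded_mono {m n : ℕ} (h : m ≤ n) :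
    expanded φ b δ p r m ⊆ expanded φ b δ p r n := by
  induction n, h using Nat.le_induction with
  | base => exact subset_rfl
  | succ n _ ih =>
    simp only [expanded]
    split_ifs
    · exact ih.trans (Finset.subset_insert _ _)
    · exact ih

theorem IsRun.ne_root (hrun : IsRun φ b δ p r) (m : ℕ) : p (m + 1) ≠ root := by
  intro h
  exact (hrun m).2 ⟨h ▸ root_mem_expanded m, Or.inl h⟩

/-- The last round in which a node was pulled. -/
theorem exists_last_pull {n : ℕ} {v : Node} (hv : 0 < pulls p n v) :
    ∃ m, m < n ∧ p (m + 1) = v ∧ pullTimes p n v = pullTimes p (m + 1) v ∧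
      pulls p n v = pulls p m v + 1 := by
  have hne : (pullTimes p n v).Nonempty := Finset.card_pos.mp hv
  set s := (pullTimes p n v).max' hne with hs
  have hmem := (pullTimes p n v).max'_mem hne
  have hmax := (pullTimes p n v).le_max'
  rw [← hs, mem_pullTimes] at hmem
  simp only [← hs] at hmax
  clear_value s
  obtain ⟨⟨h1, h2⟩, h3⟩ := hmem
  obtain ⟨m, rfl⟩ : ∃ m, s = m + 1 := ⟨s - 1, by omega⟩
  have heq : pullTimes p n v = pullTimes p (m + 1) v := by
    ext j
    constructor
    · intro hj
      have := hmax j hj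
      rw [mem_pullTimes] at hj ⊢
      exact ⟨⟨hj.1.1, this⟩, hj.2⟩
    · intro hj
      rw [mem_pullTimes] at hj ⊢
      exact ⟨⟨hj.1.1, by omega⟩, hj.2⟩
  refine ⟨m, by omega, h3, heq, ?_⟩
  have : pullTimes p (m + 1) v = insert (m + 1) (pullTimes p m v) := by
    ext j
    simp only [Finset.mem_insert, mem_pullTimes]
    constructor
    · rintro ⟨⟨a, c⟩, e⟩
      rcases Nat.lt_or_ge m j with h | h
      · left; omega
      · right; exact ⟨⟨a, h⟩, e⟩
    · rintro (rfl | ⟨⟨a, c⟩, e⟩)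
      · exact ⟨⟨by omega, le_rfl⟩, h3⟩
      · exact ⟨⟨a, by omega⟩, e⟩
  unfold pulls
  rw [heq, this, Finset.card_insert_of_notMem]
  simp [mem_pullTimes]

/-- Statistics only depend on the set of rounds in which the node was pulled. -/
theorem threshold_congr {m n t : ℕ} {v : Node} (h : pullTimes p n v = pullTimes p m v) :
    threshold φ b δ p r n t v = threshold φ b δ p r m t v := by
  have h1 : pulls p n v = pulls p m v := by unfold pulls; rw [h]
  have h2 : empMean p r n v = empMean p r m v := by unfold empMean; rw [h, h1]
  have h3 : empVar p r n v = empVar p r m v := by unfold empVar; rw [h, h1, h2]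
  unfold threshold
  rw [h3]

/-- When a node is pulled, it has fewer pulls than its threshold. -/
theorem IsRun.pulls_lt_threshold (hrun : IsRun φ b δ p r) (hφ : ∀ h, 0 < φ h) (hb : 0 < b)
    (h0 : 0 < δ) (h1 : δ ≤ 1) {m : ℕ} (hT : 0 < pulls p m (p (m + 1))) :
    (pulls p m (p (m + 1)) : ℝ) < threshold φ b δ p r m (m + 1) (p (m + 1)) := by
  set v := p (m + 1) with hv
  by_cases hE : v ∈ expanded φ b δ p r m
  · by_contra hc
    exact (hrun m).2 ⟨hE, Or.inr (not_lt.mp hc)⟩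
  -- A leaf was not expanded after its last pull, so T < τ held then. Its statistics have not
  -- changed since, and τ only grows with time.
  · obtain ⟨s, hs, hps, heq, -⟩ := exists_last_pull hT
    have hnot : ¬ threshold φ b δ p r (s + 1) (s + 1) v ≤ pulls p (s + 1) v := by
      intro hle
      apply hE
      apply expanded_mono (show s + 1 ≤ m by omega)
      simp only [expanded]
      rw [hps, if_pos hle]
      exact Finset.mem_insert_self _ _
    have hpl : pulls p m v = pulls p (s + 1) v := by unfold pulls; rw [heq]
    rw [hpl, threshold_congr heq]
    exact (not_le.mp hnot).trans_le (threshold_mono h0 h1 hb hφ (by omega) v)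

end Algorithm

/-- The parent of a node (the root is its own parent). -/
def parent (v : Node) : Node := (v.1 - 1, v.2 / 2)

theorem parent_leftChild (v : Node) : parent (leftChild v) = v := by
  ext <;> simp [parent, leftChild]

theorem parent_rightChild (v : Node) : parent (rightChild v) = v := by
  ext <;> simp [parent, rightChild]; omega

/-- The empirical quantities of every node pulled during the first `m` rounds are within their
confidence bounds, where `g v` is the mean reward of `v`. -/
def Concentrated (g : Node → ℝ) (b δ ε V : ℝ) (p : ℕ → Node) (r : ℕ → ℝ) (m : ℕ) : Prop :=
  ∀ v, 0 < pulls p m v →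
    |empMean p r m v - g v| ≤ statErr b δ p r m (m + 1) v ∧
    empVar p r m v ≤ 2 * V + b ^ 2 * confLog δ (m + 1) / pulls p m v ∧
    -- The right side is the mean square around the true mean `g v`, which is what a supermartingale
    -- can control directly.
    ε / 2 - b ^ 2 * confLog δ (m + 1) / pulls p m v
      ≤ empVar p r m v + (empMean p r m v - g v) ^ 2

/-! ### Optimism of the descent under concentration -/

section Optimism

variable {X : Type*} {P : HierPartition X} {f : X → ℝ} {xstar : X}
  {φ : ℕ → ℝ} {b δ ε V : ℝ} {p : ℕ → Node} {r : ℕ → ℝ} {m : ℕ}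

theorem le_uValue (hsm : LocallySmooth P f xstar φ)
    (hc : Concentrated (fun v => f (P.arm v)) b δ ε V p r m) {v : Node} (hv : v.2 < 2 ^ v.1)
    (hx : xstar ∈ P.cell v.1 v.2) : (f xstar : EReal) ≤ uValue φ b δ p r m (m + 1) v := by
  unfold uValue
  split_ifs with h
  · exact le_top
  · obtain ⟨h1, -, -⟩ := hc v (Nat.pos_of_ne_zero h)
    have h2 := hsm v.1 v.2 hv hx (P.arm v) (P.rep_mem v.1 v.2 hv)
    have h3 := (abs_le.mp h1).1
    exact_mod_cast (by linarith)

/-- At an internal node whose cell contains x*, one of the two children contains x* again, so the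
maximum over the children inherits the bound; the cut-off level plays no role. -/
theorem le_bAux (E : Finset Node) (U : Node → EReal) (y : EReal)
    (hU : ∀ v : Node, v.2 < 2 ^ v.1 → xstar ∈ P.cell v.1 v.2 → y ≤ U v) (k : ℕ) :
    ∀ v : Node, v.2 < 2 ^ v.1 → xstar ∈ P.cell v.1 v.2 → y ≤ bAux E U k v := by
  induction k with
  | zero => exact hU
  | succ k ih =>
    intro v hv hx
    rw [bAux]
    split_ifs
    · refine le_min (hU v hv hx) ?_
      rw [P.cell_split v.1 v.2 hv] at hx
      rcases hx with hx | hx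
      · exact le_max_of_le_left (ih (leftChild v) (by simp [leftChild, pow_succ]; omega) hx)
      · exact le_max_of_le_right (ih (rightChild v) (by simp [rightChild, pow_succ]; omega) hx)
    · exact hU v hv hx

theorem le_max_descentB_root (hsm : LocallySmooth P f xstar φ)
    (hc : Concentrated (fun v => f (P.arm v)) b δ ε V p r m) :
    (f xstar : EReal) ≤ max (descentB φ b δ p r m (leftChild root))
      (descentB φ b δ p r m (rightChild root)) := by
  have hU : ∀ v : Node, v.2 < 2 ^ v.1 → xstar ∈ P.cell v.1 v.2 →
      (f xstar : EReal) ≤ descentB φ b δ p r m v :=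
    le_bAux _ _ _ (fun v hv hx => le_uValue hsm hc hv hx) _
  have hx : xstar ∈ P.cell 0 0 := by rw [P.cell_root]; trivial
  rw [P.cell_split 0 0 (by norm_num)] at hx
  rcases hx with hx | hx
  · exact le_max_of_le_left (hU (leftChild root) (by simp [leftChild, root]) hx)
  · exact le_max_of_le_right (hU (rightChild root) (by simp [rightChild, root]) hx)

theorem bValue_le (E : Finset Node) (U : Node → EReal) (v : Node) : bValue E U v ≤ U v := by
  by_cases hv : v ∈ E
  · rw [bValue_internal E U hv]; exact min_le_left _ _
  · rw [bValue_leaf E U hv]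

theorem Visited.valid {v : Node} (h : Visited φ b δ p r m v) : v.2 < 2 ^ v.1 := by
  induction h with
  | root => simp [VHCT.root]
  | left v _ _ _ ih => simp only [leftChild, pow_succ]; omega
  | right v _ _ _ ih => simp only [rightChild, pow_succ]; omega

/-- Visited nodes other than the root have an optimistic backward value. -/
theorem Visited.le_descentB (hsm : LocallySmooth P f xstar φ)
    (hc : Concentrated (fun v => f (P.arm v)) b δ ε V p r m) {v : Node}
    (h : Visited φ b δ p r m v) :
    v = VHCT.root ∨ (f xstar : EReal) ≤ descentB φ b δ p r m v := by
  have key : ∀ v, Visited φ b δ p r m v → Passes φ b δ p r m v →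
      (v = VHCT.root ∨ (f xstar : EReal) ≤ descentB φ b δ p r m v) →
      (f xstar : EReal) ≤ max (descentB φ b δ p r m (leftChild v))
        (descentB φ b δ p r m (rightChild v)) := by
    rintro v - hp (rfl | hv)
    · exact le_max_descentB_root hsm hc
    · refine hv.trans ?_
      conv_lhs => rw [descentB, bValue_internal _ _ hp.1]
      exact min_le_right _ _
  induction h with
  | root => exact Or.inl rfl
  | left v hv hp hle ih =>
    right
    have := key v hv hp ih
    rwa [max_eq_left hle] at this
  | right v hv hp hle ih =>
    right
    have := key v hv hp ih
    rwa [max_eq_right hle] at this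

theorem Visited.eq_root_or_parent {v : Node} (h : Visited φ b δ p r m v) :
    v = VHCT.root ∨ 1 ≤ v.1 ∧ Visited φ b δ p r m (parent v) ∧ Passes φ b δ p r m (parent v) := by
  cases h with
  | root => exact Or.inl rfl
  | left v hv hp hle => rw [parent_leftChild]; exact Or.inr ⟨by simp [leftChild], hv, hp⟩
  | right v hv hp hle => rw [parent_rightChild]; exact Or.inr ⟨by simp [rightChild], hv, hp⟩

/-- The suboptimality of a visited node that has been pulled before. -/
theorem Visited.gap_le (hsm : LocallySmooth P f xstar φ)
    (hc : Concentrated (fun v => f (P.arm v)) b δ ε V p r m) {v : Node}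
    (h : Visited φ b δ p r m v) (hne : v ≠ VHCT.root) (hT : 0 < pulls p m v) :
    f xstar - f (P.arm v) ≤ φ v.1 + 2 * statErr b δ p r m (m + 1) v := by
  have h1 := ((h.le_descentB hsm hc).resolve_left hne).trans (bValue_le _ _ _)
  rw [uValue, if_neg (by omega)] at h1
  have h2 : f xstar ≤ empMean p r m v + φ v.1 + statErr b δ p r m (m + 1) v := by
    exact_mod_cast h1
  have h3 := (abs_le.mp (hc v hT).1).2
  linarith

end Optimism

/-- The `η`-optimal cells of depth `h`. -/
theorem nearOptCount_spec {X : Type*} (P : HierPartition X) (f : X → ℝ) (fstar : ℝ) (h : ℕ)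
    (η : ℝ) (S : Finset Node)
    (hS : ∀ u ∈ S, u.1 = h ∧ u.2 < 2 ^ h ∧ fstar - η ≤ sSup (f '' P.cell h u.2)) :
    S.card ≤ nearOptCount P f fstar h η := by
  classical
  unfold nearOptCount
  refine Finset.card_le_card_of_injOn Prod.snd ?_ ?_
  · intro u hu
    obtain ⟨h1, h2, h3⟩ := hS u hu
    simpa [h2] using h3
  · intro u hu w hw huw
    exact Prod.ext ((hS u hu).1.trans (hS w hw).1.symm) huw

/-! ### Regret of a single node -/

section NodeRegret

variable {X : Type*} {P : HierPartition X} {f : X → ℝ} {xstar : X}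
  {φ : ℕ → ℝ} {b δ ε V : ℝ} {p : ℕ → Node} {r : ℕ → ℝ} {n : ℕ}

/-- The total uncertainty of a node with `k` pulls that is below its threshold. -/
theorem uncertainty_total_le {φ b V W l k : ℝ} (hφ : 0 < φ) (hb : 0 < b) (hV : 0 ≤ V) (hl : 0 < l)
    (hk : 0 < k) (hWV : W ≤ 2 * V + b ^ 2 * l / k) (se : ℝ)
    (hse : se = 3 * √(2 * W * l / k) + 3 * b * 3 ^ 2 * l / k) (hlt : φ ≤ se) :
    k * se ≤ 36 * V * l / φ + 64 * b * l := by
  -- Inserting the bound on W gives 4Vl/k + 2(bl/k)² under the root; √2 is rounded up to 3/2.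
  have h1 : √(2 * W * l / k) ≤ 2 * √(V * l / k) + 3 / 2 * (b * l / k) := by
    apply Real.sqrt_le_iff.mpr ⟨by positivity, ?_⟩
    have e := Real.sq_sqrt (show 0 ≤ V * l / k by positivity)
    have : 2 * W * l / k ≤ 4 * (V * l / k) + 2 * (b * l / k) ^ 2 := by
      calc 2 * W * l / k = 2 * (l / k) * W := by ring
        _ ≤ 2 * (l / k) * (2 * V + b ^ 2 * l / k) := by gcongr
        _ = _ := by ring
    have h3 : 0 ≤ √(V * l / k) * (b * l / k) := by positivity
    have h4 : 0 ≤ (b * l / k) ^ 2 := by positivity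
    nlinarith
  obtain ⟨y, hy0, hy⟩ : ∃ y : ℝ, 0 ≤ y ∧ y ^ 2 = V * l / k :=
    ⟨√(V * l / k), by positivity, Real.sq_sqrt (by positivity)⟩
  have h2 : √(V * l / k) = y := by rw [← hy, Real.sqrt_sq hy0]
  rw [h2] at h1
  have h3 : se ≤ 6 * y + 32 * (b * l / k) := by
    have : 0 ≤ b * l / k := by positivity
    rw [hse]
    have e : 3 * b * 3 ^ 2 * l / k = 27 * (b * l / k) := by ring
    rw [e]; linarith
  -- AM-GM with weight φ: since φ ≤ `se`, the term φ/2 is absorbed into half of the left side of the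
  -- bound on `se`.
  have h4 : 6 * y ≤ φ / 2 + 18 * y ^ 2 / φ := by
    have : 0 ≤ (φ - 6 * y) ^ 2 / (2 * φ) := by positivity
    have e : (φ - 6 * y) ^ 2 / (2 * φ) = φ / 2 + 18 * y ^ 2 / φ - 6 * y := by
      field_simp; ring
    linarith
  have h5 : se ≤ 36 * y ^ 2 / φ + 64 * (b * l / k) := by
    have e : 36 * y ^ 2 / φ = 2 * (18 * y ^ 2 / φ) := by ring
    rw [e]; linarith
  calc k * se ≤ k * (36 * y ^ 2 / φ + 64 * (b * l / k)) := by gcongr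
    _ = 36 * V * l / φ + 64 * b * l := by rw [hy]; field_simp

/-- The situation of a node at its last pull: its total regret, its parent, and the number of
pulls of its parent. -/
theorem node_regret (hf0 : ∀ x, f x ∈ Set.Icc (0 : ℝ) 1)
    (hsm : LocallySmooth P f xstar φ) (hφ : ∀ h, 0 < φ h) (hb : 0 < b) (h0 : 0 < δ) (h1 : δ ≤ 1)
    (hV : 0 ≤ V)
    (hrun : IsRun φ b δ p r) (hc : ∀ m < n, Concentrated (fun v => f (P.arm v)) b δ ε V p r m)
    {v : Node} (hv : 0 < pulls p n v) :
    ∃ l : ℝ, 1 ≤ l ∧ l ≤ confLog δ n ∧ 1 ≤ v.1 ∧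
      pulls p n v * (f xstar - f (P.arm v)) ≤ l * (216 * V / φ v.1 + (384 * b + 1)) ∧
      (parent v).2 < 2 ^ (parent v).1 ∧
      f xstar - 3 * φ (parent v).1 ≤ sSup (f '' P.cell (parent v).1 (parent v).2) ∧
      (parent v ≠ root → φ (parent v).1 ≤ 1 → φ (parent v).1 * (4 * (b + 1)) ≤ ε →
        ε * l ≤ φ (parent v).1 ^ 2 * pulls p n (parent v)) := by
  obtain ⟨m, hmn, hpm, -, hpulls⟩ := exists_last_pull hv
  have hvis := (hrun m).1
  have hne := hrun.ne_root m
  have hlt : 0 < pulls p m v → _ := fun hT =>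
    hrun.pulls_lt_threshold hφ hb h0 h1 (m := m) (by rw [hpm]; exact hT)
  rw [hpm] at hvis hne hlt
  have hcm := hc m hmn
  have hl1 := one_le_confLog h0 h1 (m + 1)
  obtain ⟨hdep, hpvis, hppass⟩ := hvis.eq_root_or_parent.resolve_left hne
  have hbdd : BddAbove (f '' P.cell (parent v).1 (parent v).2) :=
    ⟨1, by rintro _ ⟨x, -, rfl⟩; exact (hf0 x).2⟩
  have hφv := hφ v.1
  refine ⟨confLog δ (m + 1), hl1, confLog_mono h0 h1 (by omega), hdep, ?_, hpvis.valid, ?_, ?_⟩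
  · rw [hpulls]
    push_cast
    have hgap1 : f xstar - f (P.arm v) ≤ 1 := by
      have := (hf0 xstar).2; have := (hf0 (P.arm v)).1; linarith
    -- A node pulled only once has regret at most 1 ≤ l, which is the summand 1 next to 384b.
    rcases Nat.eq_zero_or_pos (pulls p m v) with hz | hT
    · rw [hz]
      have : 0 ≤ 216 * V / φ v.1 := by positivity
      push_cast
      nlinarith
    · have hT' : (1 : ℝ) ≤ pulls p m v := by exact_mod_cast hT
      have hgap := hvis.gap_le hsm hcm hne hT
      have hse : φ v.1 ≤ statErr b δ p r m (m + 1) v := by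
        by_contra hcon
        exact absurd ((statErr_le_iff hφ hb h0 h1 hT).mp (not_le.mp hcon).le)
          (not_le.mpr (hlt hT))
      have htot := uncertainty_total_le hφv hb hV (by linarith) (by linarith)
        (hcm v hT).2.1 _ rfl hse
      rw [← statErr.eq_1] at htot
      have hsepos : 0 ≤ statErr b δ p r m (m + 1) v := by linarith
      -- The confidence bounds refer to the statistics before the last pull, so that pull is charged
      -- to the earlier ones by T + 1 ≤ 2T. With gap ≤ φ + 2 SE ≤ 3 SE this gives the factor 6.
      calc ((pulls p m v : ℝ) + 1) * (f xstar - f (P.arm v))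
          ≤ (pulls p m v + 1) * (3 * statErr b δ p r m (m + 1) v) := by
            apply mul_le_mul_of_nonneg_left _ (by positivity); linarith
        _ ≤ (2 * pulls p m v) * (3 * statErr b δ p r m (m + 1) v) := by
            apply mul_le_mul_of_nonneg_right _ (by positivity); linarith
        _ = 6 * (pulls p m v * statErr b δ p r m (m + 1) v) := by ring
        _ ≤ 6 * (36 * V * confLog δ (m + 1) / φ v.1 + 64 * b * confLog δ (m + 1)) := by gcongr
        _ = confLog δ (m + 1) * (216 * V / φ v.1 + 384 * b) := by ring
        _ ≤ _ := by gcongr; linarith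
  · by_cases hr : parent v = root
    · have hx : xstar ∈ P.cell (parent v).1 (parent v).2 := by
        rw [hr]; simp only [root]; rw [P.cell_root]; trivial
      have := le_csSup hbdd ⟨xstar, hx, rfl⟩
      have := hφ (parent v).1
      linarith
    · have hτ := hppass.2.resolve_left hr
      have hT := pulls_pos_of_threshold_le hφ hb h0 h1 hτ
      have hse := (statErr_le_iff hφ hb h0 h1 hT).mpr hτ
      have hgap := hpvis.gap_le hsm hcm hr hT
      have := le_csSup hbdd ⟨P.arm (parent v), P.rep_mem _ _ hpvis.valid, rfl⟩
      linarith
  · intro hr hφ1 hφε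
    have hτ := hppass.2.resolve_left hr
    have hT := pulls_pos_of_threshold_le hφ hb h0 h1 hτ
    have hT' : (0 : ℝ) < pulls p m (parent v) := by exact_mod_cast hT
    have hse := (statErr_le_iff hφ hb h0 h1 hT).mpr hτ
    obtain ⟨c1, -, c3⟩ := hcm _ hT
    set u := parent v with hu
    have hφu := hφ u.1
    set l := confLog δ (m + 1)
    have hW := empVar_nonneg p r m u
    have hlow := (le_threshold hφ hb h0 h1 m (m + 1) u).trans hτ
    set W := empVar p r m u
    have hdev : (empMean p r m u - f (P.arm u)) ^ 2 ≤ φ u.1 ^ 2 := by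
      rw [sq_le_sq, abs_of_pos hφu]; exact c1.trans hse
    have h9 : 27 * b * l ≤ φ u.1 * pulls p m u := by
      have : 27 * b * l / φ u.1 ≤ pulls p m u := by
        refine le_trans ?_ hlow
        calc 27 * b * l / φ u.1 = (3 * b * φ u.1) * (9 * l / φ u.1 ^ 2) := by field_simp; ring
          _ ≤ _ := by gcongr; linarith
      rw [div_le_iff₀ hφu] at this
      linarith
    have h10 : b ^ 2 * l / pulls p m u ≤ b * φ u.1 := by
      rw [div_le_iff₀ hT']
      have : b * (27 * b * l) ≤ b * (φ u.1 * pulls p m u) := by gcongr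
      have : 0 ≤ b ^ 2 * l := by positivity
      nlinarith
    -- By `hdev` and `h10`, W ≥ ε/2 - bφ - φ², and φ ≤ 1 together with 4(b + 1)φ ≤ ε makes the loss
    -- at most ε/4.
    have h11 : ε / 4 ≤ W := by nlinarith
    have h12 : 2 * W * (9 * l / φ u.1 ^ 2) ≤ pulls p m u := by
      refine le_trans ?_ hlow
      gcongr
      have : 0 ≤ 3 * b * φ u.1 := by positivity
      linarith
    have h13 : (pulls p m u : ℝ) ≤ pulls p n u := by exact_mod_cast pulls_mono hmn.le u
    rw [mul_div_assoc', div_le_iff₀ (by positivity)] at h12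
    have h14 : ε * l ≤ 4 * W * l := by gcongr; linarith
    have h15 : 0 ≤ W * l := by positivity
    have h16 : (pulls p m u : ℝ) * φ u.1 ^ 2 ≤ pulls p n u * φ u.1 ^ 2 := by gcongr
    nlinarith

end NodeRegret

/-! ### Counting pulls through parents -/

theorem sum_pulls_le (p : ℕ → Node) (n : ℕ) (A : Finset Node) : ∑ v ∈ A, pulls p n v ≤ n := by
  classical
  calc ∑ v ∈ A, pulls p n v = ((Finset.Icc 1 n).filter (fun s => p s ∈ A)).card := by
        rw [Finset.card_eq_sum_card_fiberwise (f := p) (t := A) (fun s hs => by simpa using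
          (Finset.mem_filter.mp hs).2)]
        refine Finset.sum_congr rfl fun v hv => ?_
        unfold pulls pullTimes
        congr 1
        ext s
        simp only [Finset.mem_filter]
        constructor
        · rintro ⟨h1, rfl⟩; exact ⟨⟨h1, hv⟩, rfl⟩
        · rintro ⟨⟨h1, -⟩, h2⟩; exact ⟨h1, h2⟩
    _ ≤ (Finset.Icc 1 n).card := Finset.card_filter_le _ _
    _ = n := by simp

/-- Positive depth excludes the root, which is its own parent and would be a third element of its
fiber. -/
theorem card_parent_fiber_le (A : Finset Node) (hA : ∀ v ∈ A, 1 ≤ v.1) (u : Node) :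
    (A.filter (fun v => parent v = u)).card ≤ 2 := by
  have : A.filter (fun v => parent v = u) ⊆ {leftChild u, rightChild u} := by
    intro v hv
    obtain ⟨h1, rfl⟩ := Finset.mem_filter.mp hv
    have h2 := hA v h1
    simp only [Finset.mem_insert, Finset.mem_singleton, leftChild, rightChild, parent,
      Prod.ext_iff]
    omega
  exact (Finset.card_le_card this).trans Finset.card_le_two

theorem sum_parent_pulls_le (p : ℕ → Node) (n : ℕ) (A : Finset Node) (hA : ∀ v ∈ A, 1 ≤ v.1) :
    ∑ v ∈ A, pulls p n (parent v) ≤ 2 * n := by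
  classical
  rw [Finset.sum_comp (fun u => pulls p n u) parent]
  calc _ ≤ ∑ u ∈ A.image parent, 2 * pulls p n u :=
        Finset.sum_le_sum fun u _ => by
          rw [smul_eq_mul]; exact Nat.mul_le_mul_right _ (card_parent_fiber_le A hA u)
    _ = 2 * ∑ u ∈ A.image parent, pulls p n u := by rw [Finset.mul_sum]
    _ ≤ 2 * n := Nat.mul_le_mul_left _ (sum_pulls_le p n _)

theorem card_le_of_parent (A : Finset Node) (hA : ∀ v ∈ A, 1 ≤ v.1) :
    A.card ≤ 2 * (A.image parent).card := by
  classical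
  exact Finset.card_le_mul_card_image (f := parent) A 2 fun u _ => card_parent_fiber_le A hA u

/-! ### Geometric sums over depths -/

section Geometric

variable {ν ρ η a : ℝ}

theorem sum_range_geometric_rpow_le (hν : 0 < ν) (hρ : 0 < ρ) (hρ' : ρ < 1) (ha : 0 < a) (N : ℕ) :
    ∑ h ∈ Finset.range (N + 1), (ν * ρ ^ h) ^ (-a) ≤ (ν * ρ ^ N) ^ (-a) * (1 - ρ ^ a)⁻¹ := by
  have hq : ρ ^ a < 1 := Real.rpow_lt_one hρ.le hρ' ha
  have hq0 : 0 < ρ ^ a := Real.rpow_pos_of_pos hρ a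
  have hq1 : 0 < 1 - ρ ^ a := by linarith
  induction N with
  | zero =>
    rw [Finset.sum_range_one]
    have : 1 ≤ (1 - ρ ^ a)⁻¹ := (one_le_inv₀ hq1).mpr (by linarith)
    exact le_mul_of_one_le_right (by positivity) this
  | succ N ih =>
    rw [Finset.sum_range_succ]
    have e : (ν * ρ ^ N) ^ (-a) = (ν * ρ ^ (N + 1)) ^ (-a) * ρ ^ a := by
      rw [pow_succ, ← mul_assoc, Real.mul_rpow (by positivity) hρ.le, mul_assoc,
        ← Real.rpow_add hρ, neg_add_cancel, Real.rpow_zero, mul_one]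
    rw [e] at ih
    refine (add_le_add_left ih _).trans (le_of_eq ?_)
    field_simp
    ring

/-- The terms grow geometrically in h, so the sum is comparable to its last term, which is at most
η^(-a). -/
theorem sum_filter_geometric_rpow_le (hν : 0 < ν) (hρ : 0 < ρ) (hρ' : ρ < 1) (ha : 0 < a)
    (hη : 0 < η) (N : ℕ) :
    ∑ h ∈ (Finset.range N).filter (fun h => η ≤ ν * ρ ^ h), (ν * ρ ^ h) ^ (-a)
      ≤ η ^ (-a) * (1 - ρ ^ a)⁻¹ := by
  have hq : ρ ^ a < 1 := Real.rpow_lt_one hρ.le hρ' ha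
  have hq1 : 0 < 1 - ρ ^ a := by linarith
  induction N with
  | zero => simp; positivity
  | succ N ih =>
    by_cases h : η ≤ ν * ρ ^ N
    · calc _ ≤ ∑ h ∈ Finset.range (N + 1), (ν * ρ ^ h) ^ (-a) :=
            Finset.sum_le_sum_of_subset_of_nonneg (Finset.filter_subset _ _)
              fun _ _ _ => by positivity
        _ ≤ (ν * ρ ^ N) ^ (-a) * (1 - ρ ^ a)⁻¹ := sum_range_geometric_rpow_le hν hρ hρ' ha N
        _ ≤ _ := by
            gcongr ?_ * _
            exact Real.rpow_le_rpow_of_nonpos hη h (by linarith)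
    · rw [Finset.range_add_one, Finset.filter_insert, if_neg h]
      exact ih

/-- Sums over nodes of a quantity that depends only on the depth. -/
theorem sum_depth_le (A : Finset Node) (φ : ℕ → ℝ) (η : ℝ) (M w : ℕ → ℝ) (hw : ∀ h, 0 ≤ w h)
    (hM : ∀ h, ((A.filter (fun v => v.1 = h)).card : ℝ) ≤ M h) :
    ∃ N, ∑ v ∈ A.filter (fun v => η ≤ φ v.1), w v.1
      ≤ ∑ h ∈ (Finset.range N).filter (fun h => η ≤ φ h), M h * w h := by
  classical
  refine ⟨A.sup Prod.fst + 1, ?_⟩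
  rw [← Finset.sum_fiberwise_of_maps_to (g := Prod.fst)
    (t := (Finset.range (A.sup Prod.fst + 1)).filter (fun h => η ≤ φ h))]
  · refine Finset.sum_le_sum fun h _ => ?_
    calc _ = ∑ v ∈ (A.filter (fun v => η ≤ φ v.1)).filter (fun v => v.1 = h), w h :=
          Finset.sum_congr rfl fun v hv => by rw [(Finset.mem_filter.mp hv).2]
      _ = ((A.filter (fun v => η ≤ φ v.1)).filter (fun v => v.1 = h)).card * w h := by
          rw [Finset.sum_const, nsmul_eq_mul]
      _ ≤ ((A.filter (fun v => v.1 = h)).card : ℝ) * w h := by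
          gcongr
          · exact hw h
          · exact Finset.filter_subset _ _
      _ ≤ M h * w h := mul_le_mul_of_nonneg_right (hM h) (hw h)
  · intro v hv
    rw [Finset.mem_filter] at hv
    simp only [Finset.mem_filter, Finset.mem_range]
    exact ⟨Nat.lt_succ_of_le (Finset.le_sup (f := Prod.fst) hv.1), hv.2⟩

end Geometric

/-! ### The pseudo-regret under concentration -/

theorem sum_gap_eq (p : ℕ → Node) (n : ℕ) (g : Node → ℝ) :
    ∑ t ∈ Finset.Icc 1 n, g (p t) = ∑ v ∈ (Finset.Icc 1 n).image p, pulls p n v * g v := by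
  classical
  rw [Finset.sum_comp]
  refine Finset.sum_congr rfl fun v _ => ?_
  rw [nsmul_eq_mul]
  rfl

/-- The pseudo-regret of a concentrated run, for an arbitrary cut-off `η` between shallow and deep
nodes. -/
theorem pseudoRegret_le {X : Type*} {P : HierPartition X} {f : X → ℝ} {xstar : X}
    {ν ρ b δ ε V K d κ η : ℝ} {p : ℕ → Node} {r : ℕ → ℝ} {n : ℕ}
    (hf0 : ∀ x, f x ∈ Set.Icc (0 : ℝ) 1)
    (hν : 0 < ν) (hρ : 0 < ρ) (hρ' : ρ < 1) (hb : 0 < b) (h0 : 0 < δ) (h1 : δ ≤ 1)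
    (hε : 0 < ε) (hV : 0 < V) (hκ : V ≤ κ * ε) (hd : 0 ≤ d) (hK : 0 ≤ K)
    (hsm : LocallySmooth P f xstar (fun h => ν * ρ ^ h))
    (hcount : ∀ h, (nearOptCount P f (f xstar) h (3 * (ν * ρ ^ h)) : ℝ) ≤ K * (ν * ρ ^ h) ^ (-d))
    (hrun : IsRun (fun h => ν * ρ ^ h) b δ p r)
    (hc : ∀ m < n, Concentrated (fun v => f (P.arm v)) b δ ε V p r m)
    (hη : 0 < η) (hην : η ≤ ρ * ν) (hη1 : η ≤ ρ) (hηε : η * (4 * (b + 1)) ≤ ρ * ε) :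
    ∑ t ∈ Finset.Icc 1 n, (f xstar - f (P.arm (p t)))
      ≤ confLog δ n * (432 * K * (1 - ρ ^ (d + 1))⁻¹ * V * η ^ (-(d + 1))
          + 2 * (384 * b + 1) * K * ν ^ (1 / 2 : ℝ) * (1 - ρ ^ (d + 1 / 2))⁻¹
            * η ^ (-(d + 1 / 2)))
        + 2 * n * (216 * κ / ρ ^ 2 * η + (384 * b + 1) / (ε * ρ ^ 2) * η ^ 2) := by
  classical
  set φ : ℕ → ℝ := fun h => ν * ρ ^ h with hφdef
  have hφ : ∀ h, 0 < φ h := fun h => by positivity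
  have hκ0 : 0 < κ := pos_of_mul_pos_left (hV.trans_le hκ) hε.le
  set B := 384 * b + 1 with hB
  have hBpos : 0 < B := by positivity
  set L := confLog δ n
  have hL : 1 ≤ L := one_le_confLog h0 h1 n
  set A := (Finset.Icc 1 n).image p with hA
  have hApos : ∀ v ∈ A, 0 < pulls p n v := by
    intro v hv
    obtain ⟨s, hs, rfl⟩ := Finset.mem_image.mp hv
    exact Finset.card_pos.mpr ⟨s, by simpa [mem_pullTimes] using hs⟩
  have hnode := fun v hv => node_regret hf0 hsm hφ hb h0 h1 hV.le hrun hc (hApos v hv)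
  have hA1 : ∀ v ∈ A, 1 ≤ v.1 := fun v hv => by
    obtain ⟨l, -, -, h, -⟩ := hnode v hv; exact h
  -- A pulled node need not be near-optimal itself, but its parent is; this is why depth h is
  -- counted through depth h - 1.
  have hcard : ∀ h, ((A.filter (fun v => v.1 = h)).card : ℝ) ≤ 2 * (K * φ h ^ (-d)) := by
    intro h
    rcases Nat.eq_zero_or_pos h with rfl | hpos
    · rw [Finset.filter_false_of_mem (fun v hv => by have := hA1 v hv; omega)]
      have := hφ 0
      simp only [Finset.card_empty, Nat.cast_zero]
      positivity
    · have e1 := card_le_of_parent (A.filter (fun v => v.1 = h))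
        (fun v hv => hA1 v (Finset.mem_filter.mp hv).1)
      have e2 := nearOptCount_spec P f (f xstar) (h - 1) (3 * φ (h - 1))
        ((A.filter (fun v => v.1 = h)).image parent) (by
          intro u hu
          obtain ⟨v, hv, rfl⟩ := Finset.mem_image.mp hu
          obtain ⟨hvA, rfl⟩ := Finset.mem_filter.mp hv
          obtain ⟨l, -, -, -, -, g1, g2, -⟩ := hnode v hvA
          exact ⟨rfl, g1, g2⟩)
      have e3 := hcount (h - 1)
      have e4 : φ (h - 1) ^ (-d) ≤ φ h ^ (-d) := by
        apply Real.rpow_le_rpow_of_nonpos (hφ h) _ (by linarith)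
        simp only [hφdef]
        gcongr ν * ?_
        exact pow_le_pow_of_le_one hρ.le hρ'.le (by omega)
      calc ((A.filter (fun v => v.1 = h)).card : ℝ)
          ≤ 2 * ((A.filter (fun v => v.1 = h)).image parent).card := by exact_mod_cast e1
        _ ≤ 2 * nearOptCount P f (f xstar) (h - 1) (3 * φ (h - 1)) := by
            gcongr
        _ ≤ 2 * (K * φ (h - 1) ^ (-d)) := by gcongr
        _ ≤ _ := by gcongr
  rw [sum_gap_eq p n (fun v => f xstar - f (P.arm v)), ← hA,
    ← Finset.sum_filter_add_sum_filter_not A (fun v => η ≤ φ v.1)]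
  apply add_le_add
  · obtain ⟨N, hN⟩ := sum_depth_le A φ η (fun h => 2 * (K * φ h ^ (-d)))
      (fun h => 216 * V / φ h + B) (fun h => by have := hφ h; positivity) hcard
    calc ∑ v ∈ A.filter (fun v => η ≤ φ v.1), pulls p n v * (f xstar - f (P.arm v))
        ≤ ∑ v ∈ A.filter (fun v => η ≤ φ v.1), L * (216 * V / φ v.1 + B) := by
          refine Finset.sum_le_sum fun v hv => ?_
          obtain ⟨l, h1l, hl, -, hreg, -⟩ := hnode v (Finset.mem_filter.mp hv).1
          have := hφ v.1
          refine hreg.trans ?_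
          gcongr
      _ = L * ∑ v ∈ A.filter (fun v => η ≤ φ v.1), (216 * V / φ v.1 + B) := by
          rw [Finset.mul_sum]
      _ ≤ L * (∑ h ∈ (Finset.range N).filter (fun h => η ≤ φ h),
            2 * (K * φ h ^ (-d)) * (216 * V / φ h + B)) := by gcongr
      _ ≤ L * (∑ h ∈ (Finset.range N).filter (fun h => η ≤ φ h),
            (432 * K * V * φ h ^ (-(d + 1))
              + 2 * B * K * ν ^ (1 / 2 : ℝ) * φ h ^ (-(d + 1 / 2)))) := by
          gcongr with h hh
          have hφh := hφ h
          have e1 : φ h ^ (-(d + 1)) = φ h ^ (-d) / φ h := by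
            rw [neg_add, Real.rpow_add hφh, Real.rpow_neg_one, div_eq_mul_inv]
          -- Half a power of φ is given away so that the geometric sum also converges for d = 0. The
          -- exponent d + 1/2 still fits the lower-order term.
          have e2 : φ h ^ (-d) ≤ ν ^ (1 / 2 : ℝ) * φ h ^ (-(d + 1 / 2)) := by
            have : φ h ^ (-d) = φ h ^ (1 / 2 : ℝ) * φ h ^ (-(d + 1 / 2)) := by
              rw [← Real.rpow_add hφh]; ring_nf
            rw [this]
            have : φ h ≤ ν := mul_le_of_le_one_right hν.le (pow_le_one₀ hρ.le hρ'.le)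
            gcongr
          calc 2 * (K * φ h ^ (-d)) * (216 * V / φ h + B)
              = 432 * K * V * (φ h ^ (-d) / φ h) + 2 * B * K * φ h ^ (-d) := by
                field_simp
                ring
            _ ≤ 432 * K * V * (φ h ^ (-d) / φ h)
                  + 2 * B * K * (ν ^ (1 / 2 : ℝ) * φ h ^ (-(d + 1 / 2))) := by gcongr
            _ = _ := by rw [e1]; ring
      _ ≤ L * (432 * K * V * (η ^ (-(d + 1)) * (1 - ρ ^ (d + 1))⁻¹)
            + 2 * B * K * ν ^ (1 / 2 : ℝ) * (η ^ (-(d + 1 / 2)) * (1 - ρ ^ (d + 1 / 2))⁻¹)) := by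
          rw [Finset.sum_add_distrib, ← Finset.mul_sum, ← Finset.mul_sum]
          gcongr
          · exact sum_filter_geometric_rpow_le hν hρ hρ' (by linarith) hη N
          · exact sum_filter_geometric_rpow_le hν hρ hρ' (by linarith) hη N
      _ = _ := by ring
  · calc ∑ v ∈ A.filter (fun v => ¬ η ≤ φ v.1), pulls p n v * (f xstar - f (P.arm v))
        ≤ ∑ v ∈ A.filter (fun v => ¬ η ≤ φ v.1),
            (216 * κ / ρ ^ 2 * η + B / (ε * ρ ^ 2) * η ^ 2) * pulls p n (parent v) := by
          refine Finset.sum_le_sum fun v hv => ?_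
          obtain ⟨hvA, hvη⟩ := Finset.mem_filter.mp hv
          rw [not_le] at hvη
          obtain ⟨l, h1l, -, hd1, hreg, -, -, hpar⟩ := hnode v hvA
          have hφv := hφ v.1
          have hpφ : φ v.1 = ρ * φ (parent v).1 := by
            simp only [hφdef, parent]
            obtain ⟨k, hk⟩ : ∃ k, v.1 = k + 1 := ⟨v.1 - 1, by omega⟩
            rw [hk, Nat.add_sub_cancel, pow_succ]; ring
          set u := parent v with hu
          -- A child of the root has φ = ρν ≥ η and is therefore shallow; the lower bound on pulls
          -- is not available for the root.
          have hur : u ≠ root := by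
            intro h
            have : φ v.1 = ρ * ν := by
              rw [hpφ, h]; simp [hφdef, root]
            linarith
          have hφu := hφ u.1
          have hu1 : φ u.1 ≤ 1 := by
            by_contra hcon
            nlinarith
          have hu2 : φ u.1 * (4 * (b + 1)) ≤ ε := by
            have : ρ * (φ u.1 * (4 * (b + 1))) ≤ ρ * ε := by
              refine le_trans ?_ hηε
              rw [← mul_assoc, ← hpφ]
              gcongr
            exact le_of_mul_le_mul_left this hρ
          have hl := hpar hur hu1 hu2
          have e0 : φ u.1 = φ v.1 / ρ := by rw [hpφ]; field_simp
          rw [e0] at hl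
          set T : ℝ := ((pulls p n u : ℕ) : ℝ) with hT
          have hT0 : 0 ≤ T := by positivity
          refine hreg.trans ?_
          -- V ≤ κε brings in the factor εl, which is at most φ(u)² T for the parent u, where φ(u) =
          -- φ(v)/ρ.
          calc l * (216 * V / φ v.1 + B) ≤ l * (216 * (κ * ε) / φ v.1 + B) := by gcongr
            _ = 216 * κ / φ v.1 * (ε * l) + B / ε * (ε * l) := by field_simp
            _ ≤ 216 * κ / φ v.1 * ((φ v.1 / ρ) ^ 2 * T) + B / ε * ((φ v.1 / ρ) ^ 2 * T) := by
                gcongr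
            _ = (216 * κ / ρ ^ 2 * φ v.1 + B / (ε * ρ ^ 2) * φ v.1 ^ 2) * T := by
                field_simp
            _ ≤ _ := by gcongr
      _ = (216 * κ / ρ ^ 2 * η + B / (ε * ρ ^ 2) * η ^ 2)
            * ((∑ v ∈ A.filter (fun v => ¬ η ≤ φ v.1), pulls p n (parent v) : ℕ) : ℝ) := by
          rw [← Finset.mul_sum, Nat.cast_sum]
      _ ≤ (216 * κ / ρ ^ 2 * η + B / (ε * ρ ^ 2) * η ^ 2) * (2 * n) := by
          gcongr
          exact_mod_cast sum_parent_pulls_le p n _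
            (fun v hv => hA1 v (Finset.mem_filter.mp hv).1)
      _ = _ := by ring

/-- A bound on the near-optimality dimension bounds the number of near-optimal cells. -/
theorem nearOptCount_le_of_nearOptDim_le {X : Type*} {P : HierPartition X} {f : X → ℝ} {xstar : X}
    {ν ρ C d : ℝ} (hν : 0 < ν) (hρ : 0 < ρ) (hρ' : ρ < 1) (hd : 0 ≤ d)
    (hdim : nearOptDim P f (f xstar) 3 C (fun h => ν * ρ ^ h) ≤ ENNReal.ofReal d) (h : ℕ) :
    (nearOptCount P f (f xstar) h (3 * (ν * ρ ^ h)) : ℝ)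
      ≤ |C| * max 1 ν ^ d * (ν * ρ ^ h) ^ (-d) := by
  have hφ : 0 < ν * ρ ^ h := by positivity
  have hφν : ν * ρ ^ h ≤ max 1 ν :=
    (mul_le_of_le_one_right hν.le (pow_le_one₀ hρ.le hρ'.le)).trans (le_max_right _ _)
  have hmax : 1 ≤ max 1 ν := le_max_left _ _
  -- The infimum need not be attained, so the count is bounded at the exponents d + 1/(k + 1), and
  -- then k → ∞. Raising an exponent from y to x costs a factor φ^(x - y) ≤ max(1, ν)^x.
  have key : ∀ k : ℕ, (nearOptCount P f (f xstar) h (3 * (ν * ρ ^ h)) : ℝ)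
      ≤ |C| * max 1 ν ^ (d + 1 / ((k : ℝ) + 1)) * (ν * ρ ^ h) ^ (-(d + 1 / ((k : ℝ) + 1))) := by
    intro k
    set x := d + 1 / ((k : ℝ) + 1) with hx
    have hdx : d < x := by
      have : 0 < 1 / ((k : ℝ) + 1) := by positivity
      linarith
    have hlt := hdim.trans_lt ((ENNReal.ofReal_lt_ofReal_iff (by linarith)).mpr hdx)
    unfold nearOptDim at hlt
    simp only [iInf_lt_iff] at hlt
    obtain ⟨y, ⟨hy0, hy⟩, hyx⟩ := hlt
    have hyx' : y < x := (ENNReal.ofReal_lt_ofReal_iff (by linarith)).mp hyx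
    calc (nearOptCount P f (f xstar) h (3 * (ν * ρ ^ h)) : ℝ) ≤ C * (ν * ρ ^ h) ^ (-y) := hy h
      _ ≤ |C| * (ν * ρ ^ h) ^ (-y) := by gcongr; exact le_abs_self C
      _ = |C| * ((ν * ρ ^ h) ^ (x - y) * (ν * ρ ^ h) ^ (-x)) := by
          rw [← Real.rpow_add hφ]; ring_nf
      _ ≤ |C| * (max 1 ν ^ x * (ν * ρ ^ h) ^ (-x)) := by
          gcongr
          calc (ν * ρ ^ h) ^ (x - y) ≤ max 1 ν ^ (x - y) :=
                Real.rpow_le_rpow hφ.le hφν (by linarith)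
            _ ≤ max 1 ν ^ x := Real.rpow_le_rpow_of_exponent_le hmax (by linarith)
      _ = _ := by ring
  have hlim : Filter.Tendsto (fun k : ℕ => d + 1 / ((k : ℝ) + 1)) Filter.atTop (nhds d) := by
    simpa using (tendsto_const_nhds (x := d)).add
      (tendsto_one_div_add_atTop_nhds_zero_nat (𝕜 := ℝ))
  have hcont : Continuous fun x : ℝ => |C| * max 1 ν ^ x * (ν * ρ ^ h) ^ (-x) := by
    have h1 : Continuous fun x : ℝ => max 1 ν ^ x :=
      Real.continuous_const_rpow (by positivity)
    have h2 : Continuous fun x : ℝ => (ν * ρ ^ h) ^ (-x) :=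
      (Real.continuous_const_rpow hφ.ne').comp continuous_neg
    exact (continuous_const.mul h1).mul h2
  exact ge_of_tendsto' ((hcont.tendsto d).comp hlim) key

theorem pseudoRegret_le_card {X : Type*} {P : HierPartition X} {f : X → ℝ} {xstar : X}
    (hf0 : ∀ x, f x ∈ Set.Icc (0 : ℝ) 1) (p : ℕ → Node) (n : ℕ) :
    ∑ t ∈ Finset.Icc 1 n, (f xstar - f (P.arm (p t))) ≤ n := by
  calc ∑ t ∈ Finset.Icc 1 n, (f xstar - f (P.arm (p t))) ≤ ∑ t ∈ Finset.Icc 1 n, (1 : ℝ) :=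
        Finset.sum_le_sum fun t _ => by
          have := (hf0 xstar).2
          have := (hf0 (P.arm (p t))).1
          linarith
    _ = n := by simp

/-- The leading and the lower-order part of the regret bound. -/
theorem exists_pseudoRegret_bound (ν ρ b C d κ : ℝ) (hν : 0 < ν) (hρ : 0 < ρ) (hρ' : ρ < 1)
    (hb : 0 < b) (hd : 0 ≤ d) :
    ∃ C₁ : ℝ, 0 ≤ C₁ ∧ ∀ ε : ℝ, 0 < ε → ∃ C₂ : ℝ, 0 ≤ C₂ ∧
      ∀ {X : Type*} {P : HierPartition X} {f : X → ℝ} {xstar : X},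
        (∀ x, f x ∈ Set.Icc (0 : ℝ) 1) →
        LocallySmooth P f xstar (fun h => ν * ρ ^ h) →
        nearOptDim P f (f xstar) 3 C (fun h => ν * ρ ^ h) ≤ ENNReal.ofReal d →
        ∀ {p : ℕ → Node} {r : ℕ → ℝ} {V δ : ℝ} {n : ℕ},
          ε ≤ V → V ≤ κ * ε → 0 < δ → δ ≤ 1 → 2 ≤ n →
          IsRun (fun h => ν * ρ ^ h) b δ p r →
          (∀ m < n, Concentrated (fun v => f (P.arm v)) b δ ε V p r m) →
          ∑ t ∈ Finset.Icc 1 n, (f xstar - f (P.arm (p t)))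
            ≤ C₁ * V ^ (1 / (d + 2)) * (n : ℝ) ^ ((d + 1) / (d + 2))
                * Real.log (n / δ) ^ (1 / (d + 2))
              + C₂ * (n : ℝ) ^ ((2 * d + 1) / (2 * d + 4)) * Real.log (n / δ) := by
  set K := |C| * max 1 ν ^ d with hK
  have hK0 : 0 ≤ K := by positivity
  have hG : ∀ a : ℝ, 0 < a → 0 < 1 - ρ ^ a := fun a ha => by
    have := Real.rpow_lt_one hρ.le hρ' ha; linarith
  have hG1 := hG (d + 1) (by linarith)
  have hG2 := hG (d + 1 / 2) (by linarith)
  set a₁ := 432 * K * (1 - ρ ^ (d + 1))⁻¹ with ha₁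
  set a₂ := 2 * (384 * b + 1) * K * ν ^ (1 / 2 : ℝ) * (1 - ρ ^ (d + 1 / 2))⁻¹ with ha₂
  have ha₁0 : 0 ≤ a₁ := by positivity
  have ha₂0 : 0 ≤ a₂ := by positivity
  refine ⟨4 * a₁ + 2 * (216 * |κ| / ρ ^ 2), by positivity, fun ε hε => ?_⟩
  -- The largest cut-off that `pseudoRegret_le` admits. It depends on ε, but enters only C₂.
  obtain ⟨η₀, hη₀, hη₀1, hη₀2, hη₀3⟩ : ∃ η₀ : ℝ, 0 < η₀ ∧ η₀ ≤ ρ * ν ∧ η₀ ≤ ρ ∧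
      η₀ * (4 * (b + 1)) ≤ ρ * ε := by
    refine ⟨min (ρ * ν) (min ρ (ρ * ε / (4 * (b + 1)))), by positivity, min_le_left _ _,
      (min_le_right _ _).trans (min_le_left _ _), ?_⟩
    rw [← le_div_iff₀ (by positivity)]
    exact (min_le_right _ _).trans (min_le_right _ _)
  set s := (2 * d + 1) / (2 * d + 4) with hs
  have hs0 : 0 ≤ s := by positivity
  set B := 384 * b + 1 with hB
  have hB0 : 0 < B := by positivity
  refine ⟨(4 * a₂ + 2 * (B * |κ| / ρ ^ 2)) * (ε / 2) ^ (-s) + |κ| * ε / η₀ ^ (d + 2),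
    by positivity, ?_⟩
  intro X P f xstar hf0 hsm hdim p r V δ n hεV hVκ h0 h1 hn hrun hc
  have hn' : (2 : ℝ) ≤ n := by exact_mod_cast hn
  have hV : 0 < V := hε.trans_le hεV
  have hκ0 : 0 < κ := pos_of_mul_pos_left (hV.trans_le hVκ) hε.le
  rw [abs_of_pos hκ0]
  set L := Real.log (n / δ) with hL
  have hL2 : 1 / 2 ≤ L := by
    have h2 : (2 : ℝ) ≤ n / δ := by rw [le_div_iff₀ h0]; nlinarith
    have := Real.log_le_log (by norm_num) h2
    have := Real.log_two_gt_d9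
    linarith
  have hL0 : 0 < L := by linarith
  have hd2 : 0 < d + 2 := by linarith
  -- This choice makes L V η^(-(d+1)) and nη both equal to the leading term `F`.
  set η := (V * L / n) ^ (1 / (d + 2)) with hη
  have hη0 : 0 < η := by positivity
  have hηpow : η ^ (d + 2) = V * L / n := by
    rw [hη, ← Real.rpow_mul (by positivity), one_div_mul_cancel hd2.ne', Real.rpow_one]
  have hn1 : 1 ≤ (n : ℝ) ^ s := Real.one_le_rpow (by linarith) hs0
  set F := V ^ (1 / (d + 2)) * (n : ℝ) ^ ((d + 1) / (d + 2)) * L ^ (1 / (d + 2)) with hF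
  have hnF : n * η = F := by
    have : (n : ℝ) ^ ((d + 1) / (d + 2)) = n / (n : ℝ) ^ (1 / (d + 2)) := by
      rw [eq_div_iff (by positivity), ← Real.rpow_add (by linarith), ← add_div,
        show d + 1 + 1 = d + 2 by ring, div_self hd2.ne', Real.rpow_one]
    rw [hF, hη, Real.div_rpow (by positivity) (by linarith), Real.mul_rpow hV.le hL0.le, this]
    ring
  have hF0 : 0 ≤ F := by positivity
  have hgoal : ∀ c₁ c₂ : ℝ, c₁ * V ^ (1 / (d + 2)) * (n : ℝ) ^ ((d + 1) / (d + 2))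
      * L ^ (1 / (d + 2)) + c₂ * (n : ℝ) ^ s * L = c₁ * F + c₂ * ((n : ℝ) ^ s * L) := by
    intro c₁ c₂; rw [hF]; ring
  rw [hgoal]
  have hnL : L ≤ (n : ℝ) ^ s * L := le_mul_of_one_le_left hL0.le hn1
  by_cases hcase : η ≤ η₀
  · have hmain := pseudoRegret_le hf0 hν hρ hρ' hb h0 h1 hε hV hVκ hd hK0 hsm
      (nearOptCount_le_of_nearOptDim_le hν hρ hρ' hd hdim) hrun hc hη0
      (hcase.trans hη₀1) (hcase.trans hη₀2)
      (le_trans (by gcongr) hη₀3)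
    set Z := η ^ (-(d + 1 / 2)) with hZ
    have hZ0 : 0 < Z := by positivity
    have e1 : L * (V * η ^ (-(d + 1))) = F := by
      have : η ^ (-(d + 1)) = η * (V * L / n)⁻¹ := by
        rw [← hηpow, ← Real.rpow_neg hη0.le]
        nth_rewrite 2 [← Real.rpow_one η]
        rw [← Real.rpow_add hη0]; ring_nf
      rw [this, ← hnF]; field_simp
    -- n η^(d+2) = VL turns nη² into VL η^(-d), which is of lower order because η ≤ 1.
    have e2 : n * η ^ 2 ≤ κ * ε * (L * Z) := by
      have h3 : η ^ 2 = η ^ (d + 2) * (Z * η ^ (1 / 2 : ℝ)) := by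
        rw [hZ, ← Real.rpow_add hη0, ← Real.rpow_add hη0, ← Real.rpow_natCast]
        congr 1; push_cast; ring
      have h4 : η ^ (1 / 2 : ℝ) ≤ 1 :=
        Real.rpow_le_one hη0.le (hcase.trans (hη₀2.trans hρ'.le)) (by norm_num)
      rw [h3, hηpow]
      calc (n : ℝ) * (V * L / n * (Z * η ^ (1 / 2 : ℝ))) = V * L * (Z * η ^ (1 / 2 : ℝ)) := by
            field_simp
        _ ≤ κ * ε * L * (Z * 1) := by gcongr
        _ = _ := by ring
    -- Z = (VL/n)^(-s), and VL ≥ ε/2 removes V and L from the negative power.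
    have e3 : L * Z ≤ (ε / 2) ^ (-s) * ((n : ℝ) ^ s * L) := by
      have : Z = (V * L / n) ^ (-s) := by
        rw [hZ, hη, ← Real.rpow_mul (by positivity)]
        congr 1
        rw [hs]; field_simp; ring
      rw [this, Real.div_rpow (by positivity) (by positivity), Real.rpow_neg (by positivity : (0 : ℝ) ≤ n),
        div_inv_eq_mul]
      have : (V * L) ^ (-s) ≤ (ε / 2) ^ (-s) := by
        apply Real.rpow_le_rpow_of_nonpos (by positivity) _ (by linarith)
        calc ε / 2 = ε * (1 / 2) := by ring
          _ ≤ V * L := by gcongr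
      calc L * ((V * L) ^ (-s) * (n : ℝ) ^ s) ≤ L * ((ε / 2) ^ (-s) * (n : ℝ) ^ s) := by gcongr
        _ = _ := by ring
    have hl := confLog_le h0 h1 le_rfl hn
    have hcoef : 0 ≤ a₁ * V * η ^ (-(d + 1)) + a₂ * Z := by positivity
    calc _ ≤ confLog δ n * (a₁ * V * η ^ (-(d + 1)) + a₂ * Z)
          + 2 * n * (216 * κ / ρ ^ 2 * η + B / (ε * ρ ^ 2) * η ^ 2) := hmain
      _ ≤ 4 * L * (a₁ * V * η ^ (-(d + 1)) + a₂ * Z)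
          + 2 * n * (216 * κ / ρ ^ 2 * η + B / (ε * ρ ^ 2) * η ^ 2) := by gcongr
      _ = 4 * a₁ * (L * (V * η ^ (-(d + 1)))) + 2 * (216 * κ / ρ ^ 2) * (n * η)
          + 4 * a₂ * (L * Z) + 2 * (B / (ε * ρ ^ 2)) * (n * η ^ 2) := by ring
      _ ≤ 4 * a₁ * F + 2 * (216 * κ / ρ ^ 2) * F
          + 4 * a₂ * (L * Z) + 2 * (B / (ε * ρ ^ 2)) * (κ * ε * (L * Z)) := by
          rw [e1, hnF]; gcongr
      _ = (4 * a₁ + 2 * (216 * κ / ρ ^ 2)) * F + (4 * a₂ + 2 * (B * κ / ρ ^ 2)) * (L * Z) := by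
          field_simp; ring
      _ ≤ (4 * a₁ + 2 * (216 * κ / ρ ^ 2)) * F
          + (4 * a₂ + 2 * (B * κ / ρ ^ 2)) * ((ε / 2) ^ (-s) * ((n : ℝ) ^ s * L)) := by gcongr
      _ ≤ (4 * a₁ + 2 * (216 * κ / ρ ^ 2)) * F
          + (4 * a₂ + 2 * (B * κ / ρ ^ 2)) * ((ε / 2) ^ (-s) * ((n : ℝ) ^ s * L))
          + κ * ε / η₀ ^ (d + 2) * ((n : ℝ) ^ s * L) := by
          apply le_add_of_nonneg_right; positivity
      _ = _ := by ring
  -- A large η means that n is at most a constant times L. The trivial bound n then suffices; it is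
  -- the second summand of C₂.
  · rw [not_le] at hcase
    have h3 : η₀ ^ (d + 2) ≤ V * L / n := by
      rw [← hηpow]; exact Real.rpow_le_rpow hη₀.le hcase.le hd2.le
    have h4 : (n : ℝ) ≤ κ * ε / η₀ ^ (d + 2) * L := by
      rw [le_div_iff₀ (by linarith)] at h3
      rw [div_mul_eq_mul_div, le_div_iff₀ (by positivity)]
      calc (n : ℝ) * η₀ ^ (d + 2) ≤ V * L := by linarith
        _ ≤ κ * ε * L := by gcongr
    calc _ ≤ (n : ℝ) := pseudoRegret_le_card hf0 p n
      _ ≤ κ * ε / η₀ ^ (d + 2) * L := h4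
      _ ≤ κ * ε / η₀ ^ (d + 2) * ((n : ℝ) ^ s * L) := by gcongr
      _ ≤ (4 * a₁ + 2 * (216 * κ / ρ ^ 2)) * F
          + (4 * a₂ + 2 * (B * κ / ρ ^ 2)) * (ε / 2) ^ (-s) * ((n : ℝ) ^ s * L)
          + κ * ε / η₀ ^ (d + 2) * ((n : ℝ) ^ s * L) := by
          apply le_add_of_nonneg_left; positivity
      _ = _ := by ring

/-! ### Exponential supermartingales -/

section Supermartingale

variable {Ω : Type*} [mΩ : MeasurableSpace Ω] {μ : Measure Ω} [IsProbabilityMeasure μ]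
  {ℱ : Filtration ℕ mΩ}

theorem integral_mul_nonpos_of_condExp_nonpos {m : MeasurableSpace Ω} (hm : m ≤ mΩ)
    {Z D : Ω → ℝ} (hZ : StronglyMeasurable[m] Z) (hZ0 : 0 ≤ᵐ[μ] Z) {K : ℝ}
    (hZK : ∀ᵐ ω ∂μ, Z ω ≤ K) (hD : Integrable D μ) (hcond : μ[D | m] ≤ᵐ[μ] 0) :
    Integrable (fun ω => Z ω * D ω) μ ∧ ∫ ω, Z ω * D ω ∂μ ≤ 0 := by
  have hint : Integrable (fun ω => Z ω * D ω) μ := by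
    refine hD.bdd_mul (c := K) (hZ.mono hm).aestronglyMeasurable ?_
    filter_upwards [hZ0, hZK] with ω h1 h2
    rwa [Real.norm_of_nonneg h1]
  refine ⟨hint, ?_⟩
  rw [← integral_condExp hm]
  have h := condExp_mul_of_stronglyMeasurable_left hZ (g := D) hint hD
  refine integral_nonpos_of_ae ?_
  filter_upwards [h, hZ0, hcond] with ω h1 h2 h3
  have : (μ[fun ω => Z ω * D ω | m]) ω = Z ω * (μ[D | m]) ω := h1
  rw [this]
  exact mul_nonpos_of_nonneg_of_nonpos h2 h3

/-- Each factor is at most one plus a predictable nonnegative multiple of an increment with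
nonpositive conditional mean, so multiplying it in does not raise the expectation. The pointwise
linear bound on W reduces everything to the conditional mean of D; the bound K secures
integrability. -/
theorem integral_prod_le_one {W D : ℕ → Ω → ℝ} {G K : ℝ} {sel : ℕ → Set Ω}
    (hsel : ∀ t, MeasurableSet[ℱ t] (sel t))
    (hW : ∀ t, StronglyMeasurable[ℱ (t + 1)] (W t)) (hW0 : ∀ t ω, 0 ≤ W t ω)
    (hK : ∀ t, ∀ᵐ ω ∂μ, W t ω ≤ K) (hD : ∀ t, Integrable (D t) μ)
    (hcond : ∀ t, μ[D t | ℱ t] ≤ᵐ[μ] 0) (hG : 0 ≤ G)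
    (hle : ∀ t, ∀ᵐ ω ∂μ, W t ω ≤ 1 + (sel t).indicator (fun _ => G) ω * D t ω) (m : ℕ) :
    Integrable (fun ω => ∏ t ∈ Finset.range m, W t ω) μ ∧
      ∫ ω, ∏ t ∈ Finset.range m, W t ω ∂μ ≤ 1 := by
  have hmeas : ∀ m, StronglyMeasurable[ℱ m] (fun ω => ∏ t ∈ Finset.range m, W t ω) := by
    intro m
    refine Finset.stronglyMeasurable_fun_prod _ fun t ht => ?_
    exact (hW t).mono (ℱ.mono (Finset.mem_range.mp ht))
  have hnn : ∀ m ω, 0 ≤ ∏ t ∈ Finset.range m, W t ω :=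
    fun m ω => Finset.prod_nonneg fun t _ => hW0 t ω
  have hbd : ∀ m, ∀ᵐ ω ∂μ, ∏ t ∈ Finset.range m, W t ω ≤ K ^ m := by
    intro m
    filter_upwards [ae_all_iff.mpr hK] with ω hω
    calc _ ≤ ∏ t ∈ Finset.range m, K := Finset.prod_le_prod (fun t _ => hW0 t ω) fun t _ => hω t
      _ = K ^ m := by simp
  have hint : ∀ m, Integrable (fun ω => ∏ t ∈ Finset.range m, W t ω) μ := by
    intro m
    refine Integrable.of_bound ((hmeas m).mono (ℱ.le m)).aestronglyMeasurable (K ^ m) ?_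
    filter_upwards [hbd m] with ω hω
    rwa [Real.norm_of_nonneg (hnn m ω)]
  refine ⟨hint m, ?_⟩
  induction m with
  | zero => simp
  | succ m ih =>
    obtain ⟨h1, h2⟩ := integral_mul_nonpos_of_condExp_nonpos (ℱ.le m)
      (Z := fun ω => (∏ t ∈ Finset.range m, W t ω) * (sel m).indicator (fun _ => G) ω)
      (D := D m) (K := K ^ m * G) ((hmeas m).mul (stronglyMeasurable_const.indicator (hsel m)))
      (Filter.Eventually.of_forall fun ω =>
        mul_nonneg (hnn m ω) (Set.indicator_nonneg (fun _ _ => hG) ω))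
      (by
        filter_upwards [hbd m] with ω hω
        exact mul_le_mul hω (Set.indicator_le_self' (fun _ _ => hG) ω)
          (Set.indicator_nonneg (fun _ _ => hG) ω) ((hnn m ω).trans hω))
      (hD m) (hcond m)
    calc ∫ ω, ∏ t ∈ Finset.range (m + 1), W t ω ∂μ
        ≤ ∫ ω, ((∏ t ∈ Finset.range m, W t ω)
            + (∏ t ∈ Finset.range m, W t ω) * (sel m).indicator (fun _ => G) ω * D m ω) ∂μ := by
          refine integral_mono_ae (hint (m + 1)) ((hint m).add h1) ?_
          filter_upwards [hle m] with ω hω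
          rw [Finset.prod_range_succ]
          calc _ ≤ (∏ t ∈ Finset.range m, W t ω)
                * (1 + (sel m).indicator (fun _ => G) ω * D m ω) :=
                mul_le_mul_of_nonneg_left hω (hnn m ω)
            _ = _ := by ring
      _ ≤ 1 := by rw [integral_add (hint m) h1]; linarith

/-- Exponential tail bound for the sum of the increments of the selected rounds. -/
theorem measure_sum_indicator_ge_le {u D : ℕ → Ω → ℝ} {G K : ℝ} {sel : ℕ → Set Ω}
    (hsel : ∀ t, MeasurableSet[ℱ t] (sel t))
    (hu : ∀ t, StronglyMeasurable[ℱ (t + 1)] (u t))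
    (hK : ∀ t, ∀ᵐ ω ∂μ, u t ω ≤ K) (hD : ∀ t, Integrable (D t) μ)
    (hcond : ∀ t, μ[D t | ℱ t] ≤ᵐ[μ] 0) (hG : 0 ≤ G)
    (hle : ∀ t, ∀ᵐ ω ∂μ, Real.exp (u t ω) ≤ 1 + G * D t ω) (m : ℕ) (x : ℝ) :
    μ.real {ω | x ≤ ∑ t ∈ Finset.range m, (sel t).indicator (u t) ω} ≤ Real.exp (-x) := by
  obtain ⟨h1, h2⟩ := integral_prod_le_one (μ := μ) (ℱ := ℱ)
    (W := fun t ω => Real.exp ((sel t).indicator (u t) ω)) (D := D) (G := G)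
    (K := Real.exp (max K 0)) hsel
    (fun t => Real.continuous_exp.comp_stronglyMeasurable
      ((hu t).indicator (ℱ.mono (Nat.le_succ t) _ (hsel t))))
    (fun t ω => (Real.exp_pos _).le)
    (fun t => by
      filter_upwards [hK t] with ω hω
      apply Real.exp_le_exp.mpr
      by_cases h : ω ∈ sel t
      · rw [Set.indicator_of_mem h]; exact hω.trans (le_max_left _ _)
      · rw [Set.indicator_of_notMem h]; exact le_max_right _ _) hD hcond hG
    (fun t => by
      filter_upwards [hle t] with ω hω
      by_cases h : ω ∈ sel t
      · rwa [Set.indicator_of_mem h, Set.indicator_of_mem h]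
      · rw [Set.indicator_of_notMem h, Set.indicator_of_notMem h]; simp) m
  have h3 := mul_meas_ge_le_integral_of_nonneg
    (Filter.Eventually.of_forall fun ω => Finset.prod_nonneg fun t _ => (Real.exp_pos _).le)
    h1 (Real.exp x)
  have h4 : {ω | x ≤ ∑ t ∈ Finset.range m, (sel t).indicator (u t) ω}
      = {ω | Real.exp x ≤ ∏ t ∈ Finset.range m, Real.exp ((sel t).indicator (u t) ω)} := by
    ext ω
    simp only [Set.mem_ofPred_eq, ← Real.exp_sum, Real.exp_le_exp]
  rw [h4, Real.exp_neg, ← one_div, le_div_iff₀ (Real.exp_pos x), mul_comm]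
  exact h3.trans h2

end Supermartingale

/-! ### Elementary exponential inequalities -/

/-- The compensator y² is random, so for centered y this gives an exponential supermartingale
without knowledge of the variance. It follows from the third-order Taylor bound at y - y². -/
theorem exp_sub_sq_le {y : ℝ} (hy : |y| ≤ 1 / 4) : Real.exp (y - y ^ 2) ≤ 1 + y := by
  set z := y - y ^ 2 with hz
  have hzy : |z| ≤ 5 / 4 * |y| := by
    calc |z| ≤ |y| + |y ^ 2| := abs_sub _ _
      _ = |y| + |y| * |y| := by rw [abs_pow, sq]
      _ ≤ |y| + 1 / 4 * |y| := by gcongr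
      _ = _ := by ring
  have hz1 : |z| ≤ 5 / 16 := by linarith
  have h := (abs_le.mp (Real.exp_bound (x := z) (by linarith) (n := 3) (by norm_num))).2
  norm_num [Finset.sum_range_succ, Nat.factorial] at h
  have h2 : z ^ 2 ≤ 25 / 16 * y ^ 2 := by
    rw [← sq_abs z, ← sq_abs y]
    calc |z| ^ 2 ≤ (5 / 4 * |y|) ^ 2 := by gcongr
      _ = _ := by ring
  have h3 : |z| ^ 3 ≤ 5 / 16 * z ^ 2 := by
    rw [← sq_abs z]
    calc |z| ^ 3 = |z| * |z| ^ 2 := by ring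
      _ ≤ _ := by gcongr
  nlinarith

/-- Hoeffding's lemma in linearized form: the chord of exp on [-l, l] lies above it, and cosh l ≤
exp(l²/2). -/
theorem exp_mul_sub_le {l x : ℝ} (hx : |x| ≤ 1) :
    Real.exp (l * x - l ^ 2 / 2) ≤ 1 + Real.exp (-(l ^ 2 / 2)) * Real.sinh l * x := by
  have h1 : Real.exp (l * x) ≤ Real.cosh l + Real.sinh l * x := by
    have hx' := abs_le.mp hx
    have hconv := convexOn_exp.2 (Set.mem_univ l) (Set.mem_univ (-l))
      (show (0 : ℝ) ≤ (1 + x) / 2 by linarith) (show (0 : ℝ) ≤ (1 - x) / 2 by linarith) (by ring)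
    simp only [smul_eq_mul] at hconv
    rw [Real.cosh_eq, Real.sinh_eq]
    calc Real.exp (l * x) = Real.exp ((1 + x) / 2 * l + (1 - x) / 2 * -l) := by congr 1; ring
      _ ≤ _ := hconv
      _ = _ := by ring
  have h2 := Real.cosh_le_exp_half_sq l
  rw [sub_eq_add_neg, Real.exp_add, mul_comm]
  have h3 : Real.exp (-(l ^ 2 / 2)) * Real.exp (l ^ 2 / 2) = 1 := by
    rw [← Real.exp_add]; simp
  calc _ ≤ Real.exp (-(l ^ 2 / 2)) * (Real.exp (l ^ 2 / 2) + Real.sinh l * x) := by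
        gcongr; linarith
    _ = _ := by rw [mul_add, h3]; ring

/-- For the upper tail of sums of squares: exp z ≤ 1 + 2z on [0, 1] and 1 + 2v ≤ exp(2v). -/
theorem exp_sub_two_mul_le {z v : ℝ} (hz0 : 0 ≤ z) (hz1 : z ≤ 1) :
    Real.exp (z - 2 * v) ≤ 1 + 2 * Real.exp (-(2 * v)) * (z - v) := by
  have h1 : Real.exp z ≤ 1 + 2 * z := by
    have := (abs_le.mp (Real.abs_exp_sub_one_sub_id_le (x := z)
      (abs_le.mpr ⟨by linarith, hz1⟩))).2
    nlinarith
  have h2 : Real.exp (-(2 * v)) * (1 + 2 * v) ≤ 1 := by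
    have h3 := Real.add_one_le_exp (2 * v)
    calc _ ≤ Real.exp (-(2 * v)) * Real.exp (2 * v) := by gcongr; linarith
      _ = 1 := by rw [← Real.exp_add]; simp
  rw [sub_eq_add_neg, Real.exp_add, mul_comm]
  calc _ ≤ Real.exp (-(2 * v)) * (1 + 2 * z) := by gcongr
    _ = Real.exp (-(2 * v)) * (1 + 2 * v) + 2 * Real.exp (-(2 * v)) * (z - v) := by ring
    _ ≤ _ := by gcongr

/-- For the lower tail: exp(-z) ≤ 1 - z/2 on [0, 1] and 1 - v/2 ≤ exp(-v/2). -/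
theorem exp_half_sub_le {z v : ℝ} (hz0 : 0 ≤ z) (hz1 : z ≤ 1) :
    Real.exp (v / 2 - z) ≤ 1 + Real.exp (v / 2) / 2 * (v - z) := by
  have h1 : Real.exp (-z) ≤ 1 - z / 2 := by
    have h := convexOn_exp.2 (Set.mem_univ (0 : ℝ)) (Set.mem_univ (-1 : ℝ))
      (show (0 : ℝ) ≤ 1 - z by linarith) hz0 (by ring)
    simp only [smul_eq_mul, mul_zero, zero_add, mul_neg, mul_one, Real.exp_zero] at h
    have : Real.exp (-1) ≤ 1 / 2 := by
      rw [Real.exp_neg, ← one_div]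
      exact one_div_le_one_div_of_le (by norm_num) (by have := Real.exp_one_gt_d9; linarith)
    nlinarith
  have h2 : Real.exp (v / 2) * (1 - v / 2) ≤ 1 := by
    have h3 := Real.add_one_le_exp (-(v / 2))
    calc _ ≤ Real.exp (v / 2) * Real.exp (-(v / 2)) := by gcongr; linarith
      _ = 1 := by rw [← Real.exp_add]; simp
  rw [sub_eq_add_neg, Real.exp_add]
  calc _ ≤ Real.exp (v / 2) * (1 - z / 2) := by gcongr
    _ = Real.exp (v / 2) * (1 - v / 2) + Real.exp (v / 2) / 2 * (v - z) := by ring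
    _ ≤ _ := by gcongr

/-! ### From exponential bounds to concentration -/

/-- Optimizing a self-normalized bound over a grid of inverse temperatures. -/
theorem abs_sum_le_of_grid {b l Q S : ℝ} {m : ℕ} (hb : 0 < b) (hl : 1 ≤ l) (hQ : 0 ≤ Q)
    (hQm : Q ≤ m * (b ^ 2 / 4))
    (hgrid : ∀ j ∈ Finset.Icc 1 (m + 1), 1 / (2 * b * j) * S - (1 / (2 * b * j)) ^ 2 * Q ≤ 4 * l) :
    S ≤ 4 * (√Q * √l) + 8 * b * l := by
  obtain ⟨q, hq0, hq⟩ : ∃ q : ℝ, 0 ≤ q ∧ q ^ 2 = Q := ⟨√Q, by positivity, Real.sq_sqrt hQ⟩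
  obtain ⟨k, hk1, hk⟩ : ∃ k : ℝ, 1 ≤ k ∧ k ^ 2 = l :=
    ⟨√l, Real.one_le_sqrt.mpr hl, Real.sq_sqrt (by linarith)⟩
  have hk0 : 0 < k := by linarith
  rw [← hq, ← hk, Real.sqrt_sq hq0, Real.sqrt_sq hk0.le]
  -- The bound λQ + 4l/λ on S is minimal at λ = 2√(l/Q), which is 1/(2bj) at j = j₀. Rounding up to
  -- an integer costs 8bl, and Q ≤ mb²/4 keeps j within the grid.
  set j₀ := q / (4 * b * k) with hj₀
  have hj₀0 : 0 ≤ j₀ := by positivity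
  have hj₀m : j₀ ≤ m := by
    rw [hj₀, div_le_iff₀ (by positivity)]
    have h1 : q ^ 2 ≤ (m * (4 * b * k)) ^ 2 := by
      rw [hq]
      refine hQm.trans ?_
      rcases Nat.eq_zero_or_pos m with rfl | hm
      · simp
      · have hm' : (1 : ℝ) ≤ m := by exact_mod_cast hm
        calc (m : ℝ) * (b ^ 2 / 4) ≤ (m * m) * (b ^ 2 * 16 * (k * k)) := by
              gcongr
              · nlinarith
              · have : 1 ≤ k * k := by nlinarith
                have : 0 < b ^ 2 := by positivity
                nlinarith
          _ = _ := by ring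
    exact le_of_sq_le_sq h1 (by positivity)
  set j : ℕ := ⌊j₀⌋₊ + 1 with hj
  have hjm : j ∈ Finset.Icc 1 (m + 1) := by
    have : ⌊j₀⌋₊ ≤ m := Nat.floor_le_of_le hj₀m
    rw [Finset.mem_Icc]; omega
  have hj1 : j₀ ≤ j := by
    have := Nat.lt_floor_add_one j₀
    rw [hj]; push_cast; linarith
  have hj2 : (j : ℝ) ≤ j₀ + 1 := by
    have := Nat.floor_le hj₀0
    rw [hj]; push_cast; linarith
  have hjpos : (0 : ℝ) < j := by rw [hj]; positivity
  have h := hgrid j hjm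
  rw [← hq, ← hk] at h
  have h1 : S ≤ q ^ 2 / (2 * b * j) + 8 * k ^ 2 * b * j := by
    have : S = (2 * b * j) * (1 / (2 * b * j) * S - (1 / (2 * b * j)) ^ 2 * q ^ 2)
        + q ^ 2 / (2 * b * j) := by field_simp; ring
    rw [this]
    have : (2 * b * j) * (1 / (2 * b * j) * S - (1 / (2 * b * j)) ^ 2 * q ^ 2)
        ≤ 2 * b * j * (4 * k ^ 2) := by gcongr
    linarith
  have h2 : q ≤ j * (4 * b * k) := by
    rw [hj₀, div_le_iff₀ (by positivity)] at hj1; exact hj1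
  have h3 : q ^ 2 / (2 * b * j) ≤ 2 * (q * k) := by
    rw [div_le_iff₀ (by positivity)]; nlinarith
  have h4 : 8 * k ^ 2 * b * j ≤ 8 * k ^ 2 * b * (j₀ + 1) := by gcongr
  have h5 : 8 * k ^ 2 * b * (j₀ + 1) = 2 * (q * k) + 8 * b * k ^ 2 := by
    rw [hj₀]; field_simp; ring
  linarith

/-- Passing from the sum of squares to the empirical variance. -/
theorem le_bernstein_of_le_sqrt {b l T V Q u : ℝ} (hb : 0 < b) (hl : 1 ≤ l) (hT : 0 < T)
    (hV : 0 ≤ V) (hQ : 0 ≤ Q) (hu : 0 ≤ u) (huT : u ≤ T * (b / 2)) (hQV : Q = T * V + u ^ 2 / T)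
    (h : u ≤ 4 * (√Q * √l) + 8 * b * l) :
    u / T ≤ 3 * √(2 * V * l / T) + 3 * b * 3 ^ 2 * l / T := by
  obtain ⟨a, ha0, ha, haT⟩ : ∃ a : ℝ, 0 ≤ a ∧ a ^ 2 = 18 * (T * V) * l ∧
      3 * √(2 * V * l / T) = a / T := by
    refine ⟨T * (3 * √(2 * V * l / T)), by positivity, ?_, by field_simp⟩
    rw [mul_pow, mul_pow, Real.sq_sqrt (by positivity)]
    field_simp
    ring
  rw [haT, ← add_div]
  gcongr
  by_contra hcon
  rw [not_le] at hcon
  set c := b * l with hc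
  have hc0 : 0 < c := by positivity
  have h1 : a + 27 * c < u := by rw [hc]; linarith
  have h2 : (u - 8 * c) ^ 2 ≤ 16 * (Q * l) := by
    have e : (4 * (√Q * √l)) ^ 2 = 16 * (Q * l) := by
      rw [mul_pow, mul_pow, Real.sq_sqrt hQ, Real.sq_sqrt (by linarith)]; norm_num
    rw [← e]
    apply pow_le_pow_left₀ (by linarith)
    rw [hc]; linarith
  -- The excess of Q over T V is only linear in u, so after squaring it merges with the cross term:
  -- u² - 24uc ≤ (8/9)a², which contradicts u > a + 27c.
  have h3 : u ^ 2 / T ≤ u * (b / 2) := by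
    rw [div_le_iff₀ hT]; nlinarith
  have h4 : 16 * (Q * l) ≤ 16 / 18 * a ^ 2 + 8 * u * c := by
    have : Q * l ≤ (T * V + u * (b / 2)) * l := by gcongr; linarith
    rw [ha, hc]; nlinarith
  nlinarith

/-! ### Pathwise criterion for concentration -/

theorem sum_range_succ_eq_sum_Icc (F : ℕ → ℝ) (m : ℕ) :
    ∑ t ∈ Finset.range m, F (t + 1) = ∑ t ∈ Finset.Icc 1 m, F t := by
  induction m with
  | zero => simp
  | succ m ih => rw [Finset.sum_range_succ, ih, Finset.sum_Icc_succ_top (by omega)]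

open Classical in
/-- The pulls of a node are the rounds that repeat its first pull. -/
theorem exists_sum_pullTimes_eq {p : ℕ → Node} {m : ℕ} {v : Node} (hv : 0 < pulls p m v) :
    ∃ s ∈ Finset.Icc 1 m, ∀ F : ℕ → ℝ,
      ∑ t ∈ Finset.range m, (if s ≤ t + 1 ∧ p (t + 1) = p s then F (t + 1) else 0)
        = ∑ t ∈ pullTimes p m v, F t := by
  have hne : (pullTimes p m v).Nonempty := Finset.card_pos.mp hv
  have hmin := (pullTimes p m v).min'_le
  have hmem := (pullTimes p m v).min'_mem hne
  set s := (pullTimes p m v).min' hne with hs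
  rw [mem_pullTimes] at hmem
  refine ⟨s, Finset.mem_Icc.mpr hmem.1, fun F => ?_⟩
  rw [sum_range_succ_eq_sum_Icc (fun t => if s ≤ t ∧ p t = p s then F t else 0),
    ← Finset.sum_filter]
  refine Finset.sum_congr ?_ fun _ _ => rfl
  ext t
  rw [Finset.mem_filter, mem_pullTimes, Finset.mem_Icc, hmem.2]
  constructor
  · rintro ⟨h1, -, h2⟩; exact ⟨h1, h2⟩
  · rintro ⟨h1, h2⟩; exact ⟨h1, hmin t (mem_pullTimes.mpr ⟨h1, h2⟩), h2⟩

section Empirical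

variable {p : ℕ → Node} {r : ℕ → ℝ} {m : ℕ} {v : Node}

theorem empMean_sub (hv : 0 < pulls p m v) (c : ℝ) :
    empMean p r m v - c = (∑ t ∈ pullTimes p m v, (r t - c)) / pulls p m v := by
  have : (pulls p m v : ℝ) ≠ 0 := by positivity
  rw [Finset.sum_sub_distrib, Finset.sum_const, nsmul_eq_mul, sub_div]
  unfold empMean
  congr 1
  exact (mul_div_cancel_left₀ c this).symm

theorem sum_sq_eq (hv : 0 < pulls p m v) (c : ℝ) :
    ∑ t ∈ pullTimes p m v, (r t - c) ^ 2
      = pulls p m v * (empVar p r m v + (empMean p r m v - c) ^ 2) := by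
  have hT : (pulls p m v : ℝ) ≠ 0 := by positivity
  set μ := empMean p r m v with hμ
  have h0 : ∑ t ∈ pullTimes p m v, (r t - μ) = 0 := by
    have := empMean_sub (r := r) hv μ
    rw [← hμ, sub_self, eq_comm, div_eq_zero_iff] at this
    exact this.resolve_right hT
  have h1 : pulls p m v * empVar p r m v = ∑ t ∈ pullTimes p m v, (r t - μ) ^ 2 := by
    unfold empVar; exact mul_div_cancel₀ _ hT
  rw [mul_add, h1]
  have h2 : ∀ t, (r t - c) ^ 2 = (r t - μ) ^ 2 + 2 * (μ - c) * (r t - μ) + (μ - c) ^ 2 :=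
    fun t => by ring
  simp only [h2, Finset.sum_add_distrib, ← Finset.mul_sum, h0, Finset.sum_const, nsmul_eq_mul]
  rw [mul_zero, add_zero]
  rfl

theorem pulls_le (p : ℕ → Node) (m : ℕ) (v : Node) : pulls p m v ≤ m :=
  (Finset.card_filter_le _ _).trans (by simp)

end Empirical

/-- Exponential-moment increments: self-normalized deviation, and the two one-sided deviations of
the sum of squares. -/
def devIncr (b : ℝ) (σ : ℝ) (j : ℕ) (x : ℝ) : ℝ :=
  1 / (2 * b * j) * (σ * x) - (1 / (2 * b * j) * (σ * x)) ^ 2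

def upperIncr (b V : ℝ) (x : ℝ) : ℝ := 4 * x ^ 2 / b ^ 2 - 2 * (4 * V / b ^ 2)

def lowerIncr (b ε : ℝ) (x : ℝ) : ℝ := 4 * ε / b ^ 2 / 2 - 4 * x ^ 2 / b ^ 2

-- A deterministic reduction: the sums are the exponents of the supermartingales below. Centering at
-- the true mean gives Q = T (V̂ + (μ̂ - g)²), which translates between sums of squares and the
-- empirical variance.
open Classical in
theorem concentrated_of_sums_lt {g : Node → ℝ} {b δ ε V : ℝ} {p : ℕ → Node} {r : ℕ → ℝ} {m : ℕ}
    (hb : 0 < b) (h0 : 0 < δ) (h1 : δ ≤ 1)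
    (hnoise : ∀ t, |r (t + 1) - g (p (t + 1))| ≤ b / 2)
    (hdev : ∀ s ∈ Finset.Icc 1 m, ∀ j ∈ Finset.Icc 1 (m + 1), ∀ σ ∈ ({1, -1} : Finset ℝ),
      ∑ t ∈ Finset.range m, (if s ≤ t + 1 ∧ p (t + 1) = p s then
        devIncr b σ j (r (t + 1) - g (p (t + 1))) else 0) < 4 * confLog δ (m + 1))
    (hupp : ∀ s ∈ Finset.Icc 1 m,
      ∑ t ∈ Finset.range m, (if s ≤ t + 1 ∧ p (t + 1) = p s then
        upperIncr b V (r (t + 1) - g (p (t + 1))) else 0) < 4 * confLog δ (m + 1))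
    (hlow : ∀ s ∈ Finset.Icc 1 m,
      ∑ t ∈ Finset.range m, (if s ≤ t + 1 ∧ p (t + 1) = p s then
        lowerIncr b ε (r (t + 1) - g (p (t + 1))) else 0) < 4 * confLog δ (m + 1)) :
    Concentrated g b δ ε V p r m := by
  intro v hv
  obtain ⟨s, hs, hsum⟩ := exists_sum_pullTimes_eq hv
  have hT : (0 : ℝ) < pulls p m v := by exact_mod_cast hv
  have hTm : (pulls p m v : ℝ) ≤ m := by exact_mod_cast pulls_le p m v
  have hl := one_le_confLog h0 h1 (m + 1)
  have hpt : ∀ t ∈ pullTimes p m v, p t = v := fun t ht => (mem_pullTimes.mp ht).2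
  have hn : ∀ t ∈ pullTimes p m v, |r t - g v| ≤ b / 2 := by
    intro t ht
    obtain ⟨⟨h1, -⟩, h2⟩ := mem_pullTimes.mp ht
    have := hnoise (t - 1)
    rwa [Nat.sub_add_cancel h1, h2] at this
  have hconv : ∀ F : ℝ → ℝ, ∑ t ∈ Finset.range m, (if s ≤ t + 1 ∧ p (t + 1) = p s then
      F (r (t + 1) - g (p (t + 1))) else 0) = ∑ t ∈ pullTimes p m v, F (r t - g v) := by
    intro F
    rw [hsum (fun t => F (r t - g (p t)))]
    exact Finset.sum_congr rfl fun t ht => by rw [hpt t ht]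
  set l := confLog δ (m + 1)
  have hupp' := hupp s hs
  have hlow' := hlow s hs
  have hdev' := fun j hj σ hσ => hdev s hs j hj σ hσ
  simp only [hconv] at hupp' hlow' hdev'
  set S := ∑ t ∈ pullTimes p m v, (r t - g v) with hS
  set Q := ∑ t ∈ pullTimes p m v, (r t - g v) ^ 2 with hQ
  have hQ0 : 0 ≤ Q := Finset.sum_nonneg fun _ _ => sq_nonneg _
  have hmean : empMean p r m v - g v = S / pulls p m v := empMean_sub hv _
  have hQeq : Q = pulls p m v * (empVar p r m v + (empMean p r m v - g v) ^ 2) := sum_sq_eq hv _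
  have hcard : ∀ c : ℝ, ∑ t ∈ pullTimes p m v, c = pulls p m v * c := fun c => by
    rw [Finset.sum_const, nsmul_eq_mul]; rfl
  have hW := empVar_nonneg p r m v
  have hSabs : |S| ≤ pulls p m v * (b / 2) := by
    rw [← hcard]
    exact (Finset.abs_sum_le_sum_abs _ _).trans (Finset.sum_le_sum hn)
  have hQle : Q ≤ pulls p m v * (b ^ 2 / 4) := by
    rw [← hcard]
    refine Finset.sum_le_sum fun t ht => ?_
    have := hn t ht
    rw [← sq_abs]
    calc |r t - g v| ^ 2 ≤ (b / 2) ^ 2 := by gcongr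
      _ = _ := by ring
  have hQV : Q / pulls p m v = empVar p r m v + (empMean p r m v - g v) ^ 2 := by
    rw [hQeq]; field_simp
  refine ⟨?_, ?_, ?_⟩
  · have hgrid : ∀ σ ∈ ({1, -1} : Finset ℝ), σ * S ≤ 4 * (√Q * √l) + 8 * b * l := by
      intro σ hσ
      have hσ2 : σ ^ 2 = 1 := by
        rcases Finset.mem_insert.mp hσ with h | h
        · rw [h]; norm_num
        · rw [Finset.mem_singleton.mp h]; norm_num
      refine abs_sum_le_of_grid (m := m) hb hl hQ0 (hQle.trans (by gcongr)) fun j hj => ?_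
      have := (hdev' j hj σ hσ).le
      simp only [devIncr, Finset.sum_sub_distrib, ← Finset.mul_sum, mul_pow, hσ2, one_mul,
        ← hS, ← hQ] at this
      exact this
    have hu : |S| ≤ 4 * (√Q * √l) + 8 * b * l := by
      rw [abs_le']
      exact ⟨by simpa using hgrid 1 (by simp), by simpa using hgrid (-1) (by simp)⟩
    have := le_bernstein_of_le_sqrt hb hl hT hW hQ0 (abs_nonneg S) hSabs
      (by rw [hQeq, hmean, sq_abs]; field_simp) hu
    rw [hmean, abs_div, abs_of_pos hT]
    exact this
  · simp only [upperIncr, Finset.sum_sub_distrib, hcard, ← Finset.mul_sum, ← Finset.sum_div,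
      ← hQ] at hupp'
    have h2 : Q ≤ pulls p m v * (2 * V + b ^ 2 * l / pulls p m v) := by
      have h3 : (4 * Q / b ^ 2 - pulls p m v * (2 * (4 * V / b ^ 2))) * (b ^ 2 / 4)
          ≤ 4 * l * (b ^ 2 / 4) := by gcongr
      have h4 : (4 * Q / b ^ 2 - pulls p m v * (2 * (4 * V / b ^ 2))) * (b ^ 2 / 4)
          = Q - pulls p m v * (2 * V) := by field_simp
      have h5 : pulls p m v * (2 * V + b ^ 2 * l / pulls p m v)
          = pulls p m v * (2 * V) + b ^ 2 * l := by field_simp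
      rw [h5]; linarith
    rw [hQeq] at h2
    have := le_of_mul_le_mul_left h2 hT
    have := sq_nonneg (empMean p r m v - g v)
    linarith
  · simp only [lowerIncr, Finset.sum_sub_distrib, hcard, ← Finset.mul_sum, ← Finset.sum_div,
      ← hQ] at hlow'
    have h2 : pulls p m v * (ε / 2 - b ^ 2 * l / pulls p m v) ≤ Q := by
      have h3 : (pulls p m v * (4 * ε / b ^ 2 / 2) - 4 * Q / b ^ 2) * (b ^ 2 / 4)
          ≤ 4 * l * (b ^ 2 / 4) := by gcongr
      have h4 : (pulls p m v * (4 * ε / b ^ 2 / 2) - 4 * Q / b ^ 2) * (b ^ 2 / 4)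
          = pulls p m v * (ε / 2) - Q := by field_simp
      have h5 : pulls p m v * (ε / 2 - b ^ 2 * l / pulls p m v)
          = pulls p m v * (ε / 2) - b ^ 2 * l := by field_simp
      rw [h5]; linarith
    rw [hQeq] at h2
    exact le_of_mul_le_mul_left h2 hT

theorem scaled_sq_le_one (hb : 0 < b) {x : ℝ} (hx : |x| ≤ b / 2) : 4 * x ^ 2 / b ^ 2 ≤ 1 := by
  rw [div_le_one (by positivity), ← sq_abs]
  calc 4 * |x| ^ 2 ≤ 4 * (b / 2) ^ 2 := by gcongr
    _ = b ^ 2 := by ring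

/-! ### The noise process of an interaction -/

theorem measurableSet_eq_node {Ω : Type*} {m : MeasurableSpace Ω} {u v : Ω → Node}
    (hu : Measurable u) (hv : Measurable v) : MeasurableSet {ω | u ω = v ω} :=
  (hu.prodMk hv) (MeasurableSet.of_discrete (s := {x : Node × Node | x.1 = x.2}))

section Noise

variable {X Ω : Type*} [mΩ : MeasurableSpace Ω] {μ : Measure Ω}
  {ℱ : Filtration ℕ mΩ} {P : HierPartition X} {f : X → ℝ} {φ : ℕ → ℝ} {b δ ε V : ℝ}
  {p : ℕ → Ω → Node} {r : ℕ → Ω → ℝ}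

/-- The noise in round `t + 1`. -/
def noise (P : HierPartition X) (f : X → ℝ) (p : ℕ → Ω → Node) (r : ℕ → Ω → ℝ) (t : ℕ) (ω : Ω) :
    ℝ :=
  r (t + 1) ω - f (P.arm (p (t + 1) ω))

/-- The event that round `t + 1 ≥ s` pulls the node of round `s`. -/
def repeatRound (p : ℕ → Ω → Node) (s t : ℕ) : Set Ω := {ω | s ≤ t + 1 ∧ p (t + 1) ω = p s ω}

namespace Interaction

theorem stronglyMeasurable_arm (H : Interaction μ ℱ P f φ b δ ε V p r) (t : ℕ) :
    StronglyMeasurable[ℱ t] (fun ω => f (P.arm (p (t + 1) ω))) :=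
  ((Measurable.of_discrete (f := fun v : Node => f (P.arm v))).comp
    (H.node_meas t)).stronglyMeasurable

theorem stronglyMeasurable_noise (H : Interaction μ ℱ P f φ b δ ε V p r) (t : ℕ) :
    StronglyMeasurable[ℱ (t + 1)] (noise P f p r t) :=
  (H.reward_meas t).stronglyMeasurable.sub
    ((H.stronglyMeasurable_arm t).mono (ℱ.mono (Nat.le_succ t)))

/-- The noise is centered at the conditional mean, so its conditional second moment is the
conditional variance. -/
theorem condExp_noise_sq (H : Interaction μ ℱ P f φ b δ ε V p r) (t : ℕ) :
    ∀ᵐ ω ∂μ, (μ[fun ω => noise P f p r t ω ^ 2 | ℱ t]) ω ∈ Set.Icc ε V := by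
  have h : Var[r (t + 1); μ | ℱ t] =ᵐ[μ] μ[fun ω => noise P f p r t ω ^ 2 | ℱ t] := by
    unfold condVar
    apply condExp_congr_ae
    filter_upwards [H.mean t] with ω hω
    simp [noise, hω]
  filter_upwards [h, H.variance t] with ω h1 h2
  rwa [← h1]

/-- The node of round t + 1 is already known at time t, so the selection is predictable. The case s
= 0 is excluded since nothing is assumed about `p 0`. -/
theorem measurableSet_repeatRound (H : Interaction μ ℱ P f φ b δ ε V p r) {s : ℕ} (hs : 1 ≤ s)
    (t : ℕ) : MeasurableSet[ℱ t] (repeatRound p s t) := by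
  by_cases h : s ≤ t + 1
  · obtain ⟨k, rfl⟩ : ∃ k, s = k + 1 := ⟨s - 1, by omega⟩
    have h1 : Measurable[ℱ t] (p (k + 1)) := (H.node_meas k).mono (ℱ.mono (by omega)) le_rfl
    have h2 : repeatRound p (k + 1) t = {ω | p (t + 1) ω = p (k + 1) ω} := by
      ext ω
      simp [repeatRound, h]
    rw [h2]
    exact measurableSet_eq_node (H.node_meas t) h1
  · have : repeatRound p s t = ∅ := by
      ext ω; simp [repeatRound, h]
    rw [this]
    exact @MeasurableSet.empty _ (ℱ t)

variable [IsProbabilityMeasure μ]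

theorem integrable_reward (H : Interaction μ ℱ P f φ b δ ε V p r) (t : ℕ) :
    Integrable (r (t + 1)) μ := by
  refine Integrable.of_bound
    ((H.reward_meas t).stronglyMeasurable.mono (ℱ.le _)).aestronglyMeasurable 1 ?_
  filter_upwards [H.reward_mem t] with ω hω
  rw [Real.norm_of_nonneg hω.1]; exact hω.2

theorem integrable_noise (H : Interaction μ ℱ P f φ b δ ε V p r) (t : ℕ) :
    Integrable (noise P f p r t) μ :=
  Integrable.of_bound ((H.stronglyMeasurable_noise t).mono (ℱ.le _)).aestronglyMeasurable (b / 2)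
    (H.noise_bdd t)

theorem integrable_noise_sq (H : Interaction μ ℱ P f φ b δ ε V p r) (t : ℕ) :
    Integrable (fun ω => noise P f p r t ω ^ 2) μ := by
  refine Integrable.of_bound
    (((H.stronglyMeasurable_noise t).pow 2).mono (ℱ.le _)).aestronglyMeasurable ((b / 2) ^ 2) ?_
  filter_upwards [H.noise_bdd t] with ω hω
  rw [norm_pow, Real.norm_eq_abs]
  exact pow_le_pow_left₀ (abs_nonneg _) hω 2

theorem condExp_noise (H : Interaction μ ℱ P f φ b δ ε V p r) (t : ℕ) :
    μ[noise P f p r t | ℱ t] =ᵐ[μ] 0 := by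
  have hint : Integrable (fun ω => f (P.arm (p (t + 1) ω))) μ := by
    have := (H.integrable_reward t).sub (H.integrable_noise t)
    refine this.congr (Filter.Eventually.of_forall fun ω => ?_)
    simp [noise]
  have h1 := condExp_sub (H.integrable_reward t) hint (ℱ t)
  have h2 := condExp_of_stronglyMeasurable (ℱ.le t) (H.stronglyMeasurable_arm t) hint
  rw [h2] at h1
  filter_upwards [h1, H.mean t] with ω e1 e2
  have : (μ[noise P f p r t | ℱ t]) ω = (μ[r (t + 1) | ℱ t] - fun ω => f (P.arm (p (t + 1) ω))) ω :=
    e1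
  rw [this, Pi.sub_apply, e2]
  simp

theorem variance_lower_le_upper (H : Interaction μ ℱ P f φ b δ ε V p r) : ε ≤ V := by
  obtain ⟨ω, hω⟩ := (H.variance 0).exists
  exact hω.1.trans hω.2

theorem measure_devIncr_le (H : Interaction μ ℱ P f φ b δ ε V p r) (hb : 0 < b) {s j : ℕ}
    (hs : 1 ≤ s) (hj : 1 ≤ j) {σ : ℝ} (hσ : |σ| = 1) (m : ℕ) (x : ℝ) :
    μ.real {ω | x ≤ ∑ t ∈ Finset.range m,
      (repeatRound p s t).indicator (fun ω => devIncr b σ j (noise P f p r t ω)) ω}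
      ≤ Real.exp (-x) := by
  have hj' : (1 : ℝ) ≤ j := by exact_mod_cast hj
  have hy : ∀ t, ∀ᵐ ω ∂μ, |1 / (2 * b * j) * (σ * noise P f p r t ω)| ≤ 1 / 4 := by
    intro t
    filter_upwards [H.noise_bdd t] with ω hω
    rw [abs_mul, abs_mul, hσ, one_mul, abs_of_pos (by positivity)]
    calc 1 / (2 * b * j) * |noise P f p r t ω| ≤ 1 / (2 * b * 1) * (b / 2) := by
          gcongr; exact hω
      _ = 1 / 4 := by field_simp; norm_num
  refine measure_sum_indicator_ge_le (ℱ := ℱ) (D := fun t ω => σ * noise P f p r t ω)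
    (G := 1 / (2 * b * j)) (K := 1 / 4) (H.measurableSet_repeatRound hs) (fun t => ?_) (fun t => ?_)
    (fun t => (H.integrable_noise t).const_mul σ) (fun t => ?_) (by positivity) (fun t => ?_) m x
  · have h := ((H.stronglyMeasurable_noise t).const_mul σ).const_mul (1 / (2 * b * j))
    exact h.sub (h.pow 2)
  · filter_upwards [hy t] with ω hω
    have := (abs_le.mp hω).2
    unfold devIncr
    nlinarith [sq_nonneg (1 / (2 * b * j) * (σ * noise P f p r t ω))]
  · filter_upwards [condExp_smul σ (noise P f p r t) (ℱ t) (μ := μ), H.condExp_noise t]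
      with ω h1 h2
    refine (h1.trans ?_).le
    rw [Pi.smul_apply, h2]; simp
  · filter_upwards [hy t] with ω hω
    exact exp_sub_sq_le hω

theorem measure_upperIncr_le (H : Interaction μ ℱ P f φ b δ ε V p r) (hb : 0 < b) {s : ℕ}
    (hs : 1 ≤ s) (m : ℕ) (x : ℝ) :
    μ.real {ω | x ≤ ∑ t ∈ Finset.range m,
      (repeatRound p s t).indicator (fun ω => upperIncr b V (noise P f p r t ω)) ω}
      ≤ Real.exp (-x) := by
  refine measure_sum_indicator_ge_le (ℱ := ℱ)
    (D := fun t ω => noise P f p r t ω ^ 2 - V)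
    (G := 2 * Real.exp (-(2 * (4 * V / b ^ 2))) * (4 / b ^ 2)) (K := 1 - 2 * (4 * V / b ^ 2))
    (H.measurableSet_repeatRound hs) (fun t => ?_) (fun t => ?_)
    (fun t => (H.integrable_noise_sq t).sub (integrable_const V)) (fun t => ?_) (by positivity)
    (fun t => ?_) m x
  · have h := ((H.stronglyMeasurable_noise t).pow 2).const_mul (4 : ℝ)
    exact (h.div (stronglyMeasurable_const (b := b ^ 2))).sub stronglyMeasurable_const
  · filter_upwards [H.noise_bdd t] with ω hω
    exact sub_le_sub_right (scaled_sq_le_one hb hω) _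
  · filter_upwards [condExp_sub (H.integrable_noise_sq t) (integrable_const V) (ℱ t),
      H.condExp_noise_sq t] with ω h1 h2
    have h3 : (μ[fun ω => noise P f p r t ω ^ 2 - V | ℱ t]) ω
        = (μ[fun ω => noise P f p r t ω ^ 2 | ℱ t] - μ[fun _ => V | ℱ t]) ω := h1
    rw [h3, Pi.sub_apply, condExp_const (ℱ.le t)]
    simpa using h2.2
  · filter_upwards [H.noise_bdd t] with ω hω
    refine (exp_sub_two_mul_le (v := 4 * V / b ^ 2) (by positivity)
      (scaled_sq_le_one hb hω)).trans (le_of_eq ?_)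
    unfold noise
    ring

theorem measure_lowerIncr_le (H : Interaction μ ℱ P f φ b δ ε V p r) (hb : 0 < b) {s : ℕ}
    (hs : 1 ≤ s) (m : ℕ) (x : ℝ) :
    μ.real {ω | x ≤ ∑ t ∈ Finset.range m,
      (repeatRound p s t).indicator (fun ω => lowerIncr b ε (noise P f p r t ω)) ω}
      ≤ Real.exp (-x) := by
  refine measure_sum_indicator_ge_le (ℱ := ℱ)
    (D := fun t ω => ε - noise P f p r t ω ^ 2)
    (G := Real.exp (4 * ε / b ^ 2 / 2) / 2 * (4 / b ^ 2)) (K := 4 * ε / b ^ 2 / 2)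
    (H.measurableSet_repeatRound hs) (fun t => ?_) (fun t => ?_)
    (fun t => (integrable_const ε).sub (H.integrable_noise_sq t)) (fun t => ?_) (by positivity)
    (fun t => ?_) m x
  · have h := ((H.stronglyMeasurable_noise t).pow 2).const_mul (4 : ℝ)
    exact stronglyMeasurable_const.sub (h.div (stronglyMeasurable_const (b := b ^ 2)))
  · refine Filter.Eventually.of_forall fun ω => ?_
    exact sub_le_self _ (by positivity)
  · filter_upwards [condExp_sub (integrable_const ε) (H.integrable_noise_sq t) (ℱ t),
      H.condExp_noise_sq t] with ω h1 h2
    have h3 : (μ[fun ω => ε - noise P f p r t ω ^ 2 | ℱ t]) ω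
        = (μ[fun _ => ε | ℱ t] - μ[fun ω => noise P f p r t ω ^ 2 | ℱ t]) ω := h1
    rw [h3, Pi.sub_apply, condExp_const (ℱ.le t)]
    simpa using h2.1
  · filter_upwards [H.noise_bdd t] with ω hω
    refine (exp_half_sub_le (v := 4 * ε / b ^ 2) (by positivity)
      (scaled_sq_le_one hb hω)).trans (le_of_eq ?_)
    unfold noise
    ring

/-- Azuma's inequality for the sum of the noise. -/
theorem measure_sum_noise_le (H : Interaction μ ℱ P f φ b δ ε V p r)
    (hf0 : ∀ x, f x ∈ Set.Icc (0 : ℝ) 1) {n : ℕ} (hn : 1 ≤ n) {L : ℝ} (hL : 0 ≤ L) :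
    μ.real {ω | √(2 * n * L) ≤ ∑ t ∈ Finset.range n, -noise P f p r t ω} ≤ Real.exp (-L) := by
  have hn' : (1 : ℝ) ≤ n := by exact_mod_cast hn
  have hx : ∀ t, ∀ᵐ ω ∂μ, |-noise P f p r t ω| ≤ 1 := by
    intro t
    filter_upwards [H.reward_mem t] with ω hω
    have h1 := hf0 (P.arm (p (t + 1) ω))
    rw [abs_neg]
    unfold noise
    rw [abs_le]
    constructor <;> linarith [hω.1, hω.2, h1.1, h1.2]
  set a := √(2 * n * L) with ha
  have ha2 : a ^ 2 = 2 * n * L := Real.sq_sqrt (by positivity)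
  have ha0 : 0 ≤ a := Real.sqrt_nonneg _
  -- The optimal exponent: l a - n l²/2 = L.
  set l := a / n with hl
  have hl0 : 0 ≤ l := by positivity
  refine le_trans ?_ (measure_sum_indicator_ge_le (ℱ := ℱ) (μ := μ) (sel := fun _ => Set.univ)
    (u := fun t ω => l * -noise P f p r t ω - l ^ 2 / 2)
    (D := fun t ω => -noise P f p r t ω)
    (G := Real.exp (-(l ^ 2 / 2)) * Real.sinh l) (K := l)
    (fun t => MeasurableSet.univ) (fun t => ?_) (fun t => ?_)
    (fun t => (H.integrable_noise t).neg) (fun t => ?_)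
    (mul_nonneg (Real.exp_pos _).le (Real.sinh_nonneg_iff.mpr hl0)) (fun t => ?_) n L)
  · refine measureReal_mono ?_
    intro ω hω
    simp only [Set.mem_ofPred_eq] at hω ⊢
    simp only [Set.indicator_univ, Finset.sum_sub_distrib, ← Finset.mul_sum, Finset.sum_const,
      Finset.card_range, nsmul_eq_mul]
    have h1 : l * a ≤ l * ∑ t ∈ Finset.range n, -noise P f p r t ω := by gcongr
    have h2 : l * a = 2 * L := by
      rw [hl, div_mul_eq_mul_div, ← sq, ha2]; field_simp
    have h3 : (n : ℝ) * (l ^ 2 / 2) = L := by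
      rw [hl, div_pow, ha2]; field_simp
    linarith
  · exact ((H.stronglyMeasurable_noise t).neg.const_mul l).sub stronglyMeasurable_const
  · filter_upwards [hx t] with ω hω
    have := (abs_le.mp hω).2
    nlinarith [sq_nonneg l]
  · filter_upwards [condExp_neg (noise P f p r t) (ℱ t) (μ := μ), H.condExp_noise t]
      with ω h1 h2
    refine (h1.trans ?_).le
    rw [Pi.neg_apply, h2]; simp
  · filter_upwards [hx t] with ω hω
    exact exp_mul_sub_le hω

end Interaction
end Noise

/-- The fourth power leaves a summable rest after about 2m² tests in the union bound; t⁺ > t gives m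
+ 2. -/
theorem exp_neg_four_mul_confLog_le {δ : ℝ} (h0 : 0 < δ) (h1 : δ ≤ 1) (m : ℕ) :
    Real.exp (-(4 * confLog δ (m + 1))) ≤ δ / (81 * ((m : ℝ) + 2) ^ 4) := by
  have ht : (m : ℝ) + 2 ≤ tPlus (m + 1) := by exact_mod_cast lt_tPlus (m + 1)
  have hm : (0 : ℝ) < (m : ℝ) + 2 := by positivity
  have ht0 := hm.trans_le ht
  rw [confLog_eq h0 h1, Real.exp_neg, show (4 : ℝ) * Real.log (3 * tPlus (m + 1) / δ)
    = Real.log ((3 * tPlus (m + 1) / δ) ^ 4) by rw [Real.log_pow]; norm_num,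
    Real.exp_log (by positivity), ← inv_pow, inv_div, div_pow]
  have h4 : δ ^ 4 ≤ δ := pow_le_of_le_one h0.le h1 (by norm_num)
  have h5 : 81 * ((m : ℝ) + 2) ^ 4 ≤ (3 * (tPlus (m + 1) : ℝ)) ^ 4 := by
    rw [mul_pow]; norm_num; gcongr
  gcongr

/-! ### Union bound over rounds -/

section Union

variable {X Ω : Type*} [mΩ : MeasurableSpace Ω] {μ : Measure Ω} [IsProbabilityMeasure μ]
  {ℱ : Filtration ℕ mΩ} {P : HierPartition X} {f : X → ℝ} {φ : ℕ → ℝ} {b δ ε V : ℝ}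
  {p : ℕ → Ω → Node} {r : ℕ → Ω → ℝ}

namespace Interaction

/-- The union is over the round s of the first pull. For each s there are 2(m + 1) self-normalized
tests, one per grid point and sign, and two for the sum of squares. -/
theorem measure_not_concentrated_le (H : Interaction μ ℱ P f φ b δ ε V p r) (hb : 0 < b)
    (h0 : 0 < δ) (h1 : δ ≤ 1) (m : ℕ) :
    μ.real {ω | ¬ Concentrated (fun v => f (P.arm v)) b δ ε V (fun t => p t ω) (fun t => r t ω) m}
      ≤ m * (2 * (m + 1) + 2) * Real.exp (-(4 * confLog δ (m + 1))) := by
  classical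
  set x := 4 * confLog δ (m + 1) with hx
  set A : ℕ → ℕ → ℝ → Set Ω := fun s j σ => {ω | x ≤ ∑ t ∈ Finset.range m,
    (repeatRound p s t).indicator (fun ω => devIncr b σ j (noise P f p r t ω)) ω} with hA
  set B : ℕ → Set Ω := fun s => {ω | x ≤ ∑ t ∈ Finset.range m,
    (repeatRound p s t).indicator (fun ω => upperIncr b V (noise P f p r t ω)) ω} with hB
  set D : ℕ → Set Ω := fun s => {ω | x ≤ ∑ t ∈ Finset.range m,
    (repeatRound p s t).indicator (fun ω => lowerIncr b ε (noise P f p r t ω)) ω} with hD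
  set E : ℕ → Set Ω := fun s =>
    ((⋃ j ∈ Finset.Icc 1 (m + 1), A s j 1 ∪ A s j (-1)) ∪ B s) ∪ D s with hE
  have hsub : {ω | ¬ Concentrated (fun v => f (P.arm v)) b δ ε V (fun t => p t ω)
      (fun t => r t ω) m} ≤ᵐ[μ] ⋃ s ∈ Finset.Icc 1 m, E s := by
    filter_upwards [ae_all_iff.mpr H.noise_bdd] with ω hω hnot
    by_contra hcon
    refine hnot (concentrated_of_sums_lt hb h0 h1 hω ?_ ?_ ?_)
    · intro s hs j hj σ hσ
      by_contra hge
      refine hcon (Set.mem_biUnion hs (Or.inl (Or.inl (Set.mem_biUnion hj ?_))))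
      have hmem : ω ∈ A s j σ := by
        refine (not_lt.mp hge).trans (le_of_eq (Finset.sum_congr rfl fun t _ => ?_))
        rw [Set.indicator_apply]; exact if_congr Iff.rfl rfl rfl
      rcases Finset.mem_insert.mp hσ with h | h
      · exact Or.inl (h ▸ hmem)
      · exact Or.inr (Finset.mem_singleton.mp h ▸ hmem)
    · intro s hs
      by_contra hge
      refine hcon (Set.mem_biUnion hs (Or.inl (Or.inr ?_)))
      refine (not_lt.mp hge).trans (le_of_eq (Finset.sum_congr rfl fun t _ => ?_))
      rw [Set.indicator_apply]; exact if_congr Iff.rfl rfl rfl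
    · intro s hs
      by_contra hge
      refine hcon (Set.mem_biUnion hs (Or.inr ?_))
      refine (not_lt.mp hge).trans (le_of_eq (Finset.sum_congr rfl fun t _ => ?_))
      rw [Set.indicator_apply]; exact if_congr Iff.rfl rfl rfl
  have hEs : ∀ s ∈ Finset.Icc 1 m, μ.real (E s) ≤ (2 * (m + 1) + 2) * Real.exp (-x) := by
    intro s hs
    have hs1 := (Finset.mem_Icc.mp hs).1
    have hU : μ.real (⋃ j ∈ Finset.Icc 1 (m + 1), A s j 1 ∪ A s j (-1))
        ≤ 2 * (m + 1) * Real.exp (-x) := by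
      refine (measureReal_biUnion_finset_le _ _).trans ?_
      calc _ ≤ ∑ j ∈ Finset.Icc 1 (m + 1), 2 * Real.exp (-x) := by
            refine Finset.sum_le_sum fun j hj => ?_
            have hj1 := (Finset.mem_Icc.mp hj).1
            have e1 := H.measure_devIncr_le hb hs1 hj1 (σ := 1) (by simp) m x
            have e2 := H.measure_devIncr_le hb hs1 hj1 (σ := -1) (by simp) m x
            refine (measureReal_union_le _ _).trans ?_
            rw [two_mul]
            exact add_le_add e1 e2
        _ = _ := by simp; ring
    have e3 := H.measure_upperIncr_le hb hs1 m x
    have e4 := H.measure_lowerIncr_le hb hs1 m x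
    refine (measureReal_union_le _ _).trans
      ((add_le_add (measureReal_union_le _ _) e4).trans ?_)
    refine (add_le_add_left (add_le_add hU e3) _).trans (le_of_eq ?_)
    ring
  calc _ ≤ μ.real (⋃ s ∈ Finset.Icc 1 m, E s) :=
        ENNReal.toReal_mono (measure_ne_top _ _) (measure_mono_ae hsub)
    _ ≤ ∑ s ∈ Finset.Icc 1 m, μ.real (E s) := measureReal_biUnion_finset_le _ _
    _ ≤ ∑ s ∈ Finset.Icc 1 m, (2 * ((m : ℝ) + 1) + 2) * Real.exp (-x) := Finset.sum_le_sum hEs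
    _ = _ := by simp; ring

/-- The failure probability after m rounds is of order δ/m², and it is compared with the telescoping
series of 1/((m + 1)(m + 2)). -/
theorem measure_exists_not_concentrated_le (H : Interaction μ ℱ P f φ b δ ε V p r) (hb : 0 < b)
    (h0 : 0 < δ) (h1 : δ ≤ 1) (n : ℕ) :
    μ.real {ω | ¬ ∀ m < n,
      Concentrated (fun v => f (P.arm v)) b δ ε V (fun t => p t ω) (fun t => r t ω) m}
      ≤ δ / 4 := by
  have hsub : {ω | ¬ ∀ m < n,
      Concentrated (fun v => f (P.arm v)) b δ ε V (fun t => p t ω) (fun t => r t ω) m}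
      ⊆ ⋃ m ∈ Finset.range n, {ω | ¬ Concentrated (fun v => f (P.arm v)) b δ ε V
        (fun t => p t ω) (fun t => r t ω) m} := by
    intro ω hω
    simp only [Set.mem_ofPred_eq, not_forall] at hω
    obtain ⟨m, hm, hc⟩ := hω
    exact Set.mem_biUnion (Finset.mem_coe.mpr (Finset.mem_range.mpr hm)) hc
  have hterm : ∀ m : ℕ, m * (2 * ((m : ℝ) + 1) + 2) * Real.exp (-(4 * confLog δ (m + 1)))
      ≤ δ / 4 * (1 / ((m : ℝ) + 1) - 1 / ((m : ℝ) + 2)) := by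
    intro m
    have e : (1 : ℝ) / ((m : ℝ) + 1) - 1 / ((m : ℝ) + 2) = 1 / (((m : ℝ) + 1) * ((m : ℝ) + 2)) := by
      field_simp; ring
    rw [e]
    calc m * (2 * ((m : ℝ) + 1) + 2) * Real.exp (-(4 * confLog δ (m + 1)))
        ≤ m * (2 * ((m : ℝ) + 1) + 2) * (δ / (81 * ((m : ℝ) + 2) ^ 4)) := by
          gcongr; exact exp_neg_four_mul_confLog_le h0 h1 m
      _ = δ * (2 * m / (81 * ((m : ℝ) + 2) ^ 3)) := by field_simp; ring
      _ ≤ δ * (1 / (4 * (((m : ℝ) + 1) * ((m : ℝ) + 2)))) := by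
          gcongr ?_ * ?_
          rw [div_le_div_iff₀ (by positivity) (by positivity)]
          have : (0 : ℝ) ≤ m := by positivity
          nlinarith [pow_nonneg this 3, sq_nonneg (m : ℝ)]
      _ = _ := by field_simp
  have htel : ∀ n : ℕ, ∑ m ∈ Finset.range n, (1 / ((m : ℝ) + 1) - 1 / ((m : ℝ) + 2))
      = 1 - 1 / ((n : ℝ) + 1) := by
    intro n
    induction n with
    | zero => simp
    | succ n ih => rw [Finset.sum_range_succ, ih]; push_cast; ring
  calc _ ≤ μ.real (⋃ m ∈ Finset.range n, {ω | ¬ Concentrated (fun v => f (P.arm v)) b δ ε V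
        (fun t => p t ω) (fun t => r t ω) m}) := measureReal_mono hsub (measure_ne_top _ _)
    _ ≤ ∑ m ∈ Finset.range n, δ / 4 * (1 / ((m : ℝ) + 1) - 1 / ((m : ℝ) + 2)) :=
        (measureReal_biUnion_finset_le _ _).trans (Finset.sum_le_sum fun m _ =>
          (H.measure_not_concentrated_le hb h0 h1 m).trans (hterm m))
    _ = δ / 4 * (1 - 1 / ((n : ℝ) + 1)) := by rw [← Finset.mul_sum, htel]
    _ ≤ δ / 4 * 1 := by
        gcongr
        have : 0 ≤ 1 / ((n : ℝ) + 1) := by positivity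
        linarith
    _ = _ := by ring

end Interaction
end Union

/-! ### From pseudo-regret to regret -/

/-- The regret splits into the pseudo-regret and the accumulated noise. -/
theorem regret_eq {X Ω : Type*} (P : HierPartition X) (f : X → ℝ) (fstar : ℝ)
    (p : ℕ → Ω → Node) (r : ℕ → Ω → ℝ) (n : ℕ) (ω : Ω) :
    regret fstar r n ω = ∑ t ∈ Finset.Icc 1 n, (fstar - f (P.arm (p t ω)))
      + ∑ t ∈ Finset.range n, -noise P f p r t ω := by
  unfold regret noise
  rw [sum_range_succ_eq_sum_Icc (fun t => -(r t ω - f (P.arm (p t ω)))),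
    ← Finset.sum_add_distrib]
  exact Finset.sum_congr rfl fun t _ => by ring

/-- A bound that holds with probability `1 - δ` for a variable that is at most `M` gives a bound
for the expectation. -/
theorem integral_le_of_measure_le {Ω : Type*} [MeasurableSpace Ω] {μ : Measure Ω}
    [IsProbabilityMeasure μ] {R : Ω → ℝ} {a M δ : ℝ} (hR : Measurable R) (hint : Integrable R μ)
    (ha : 0 ≤ a) (hM : 0 ≤ M) (hRM : ∀ᵐ ω ∂μ, R ω ≤ M) (hδ : 1 - δ ≤ μ.real {ω | R ω ≤ a}) :
    ∫ ω, R ω ∂μ ≤ a + M * δ := by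
  have hs : MeasurableSet {ω | R ω ≤ a} := measurableSet_le hR measurable_const
  have hc : μ.real {ω | R ω ≤ a}ᶜ ≤ δ := by
    rw [measureReal_compl hs, probReal_univ]; linarith
  calc ∫ ω, R ω ∂μ ≤ ∫ ω, (a + ({ω | R ω ≤ a}ᶜ).indicator (fun _ => M) ω) ∂μ := by
        refine integral_mono_ae hint
          ((integrable_const a).add ((integrable_const M).indicator hs.compl)) ?_
        filter_upwards [hRM] with ω hω
        by_cases h : R ω ≤ a
        · have : 0 ≤ ({ω | R ω ≤ a}ᶜ).indicator (fun _ => M) ω :=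
            Set.indicator_nonneg (fun _ _ => hM) ω
          show R ω ≤ a + _
          linarith
        · show R ω ≤ a + _
          rw [Set.indicator_of_mem (by simpa using h)]
          linarith
    _ = a + M * μ.real {ω | R ω ≤ a}ᶜ := by
        rw [integral_add (integrable_const a) ((integrable_const M).indicator hs.compl),
          integral_indicator hs.compl]
        simp [mul_comm]
    _ ≤ a + M * δ := by gcongr

end VHCT
end

theorem mainTheorem2 (ν₁ ρ b C d κ : ℝ) (hν₁ : 0 < ν₁) (hρ₀ : 0 < ρ) (hρ₁ : ρ < 1)
    (hb : 0 < b) (hd : 0 ≤ d) :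
    ∃ C₁ : ℝ, 0 ≤ C₁ ∧ ∀ ε : ℝ, 0 < ε → ∃ C₂ : ℝ, 0 ≤ C₂ ∧
      ∀ (X : Type*) (P : VHCT.HierPartition X) (f : X → ℝ) (xstar : X),
        (∀ x, f x ∈ Set.Icc (0 : ℝ) 1) →
        (∀ x, f x ≤ f xstar) →
        VHCT.LocallySmooth P f xstar (fun h => ν₁ * ρ ^ h) →
        VHCT.nearOptDim P f (f xstar) 3 C (fun h => ν₁ * ρ ^ h) ≤ ENNReal.ofReal d →
        ∀ (Ω : Type*) [MeasurableSpace Ω] (μ : Measure Ω) [IsProbabilityMeasure μ]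
          (ℱ : Filtration ℕ ‹MeasurableSpace Ω›) (p : ℕ → Ω → VHCT.Node) (r : ℕ → Ω → ℝ)
          (Vmax δ : ℝ) (n : ℕ),
          Vmax ≤ κ * ε → 0 < δ → δ ≤ 1 → 1 ≤ n →
          VHCT.Interaction μ ℱ P f (fun h => ν₁ * ρ ^ h) b δ ε Vmax p r →
          1 - δ ≤ μ.real {ω | VHCT.regret (f xstar) r n ω ≤ VHCT.regretBound C₁ C₂ Vmax d δ n} ∧
          (δ = 1 / n →
            Integrable (VHCT.regret (f xstar) r n) μ ∧
            ∫ ω, VHCT.regret (f xstar) r n ω ∂μ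
              ≤ VHCT.regretBound C₁ C₂ Vmax d (1 / n) n) := by
  obtain ⟨C₁, hC₁, hex⟩ := VHCT.exists_pseudoRegret_bound ν₁ ρ b C d κ hν₁ hρ₀ hρ₁ hb hd
  refine ⟨C₁, hC₁, fun ε hε => ?_⟩
  obtain ⟨C₂, hC₂, hbound⟩ := hex ε hε
  refine ⟨C₂, hC₂, ?_⟩
  intro X P f xstar hf0 _ hsm hdim Ω _ μ _ ℱ p r V δ n hVκ h0 h1 hn H
  have hn' : (1 : ℝ) ≤ n := by exact_mod_cast hn
  have hεV := H.variance_lower_le_upper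
  have hV : 0 < V := hε.trans_le hεV
  set Λ := Real.log (4 * n ^ 2 / δ) with hΛ
  have hbase : 4 ≤ 4 * (n : ℝ) ^ 2 / δ := by
    rw [le_div_iff₀ h0]; nlinarith
  have hΛ1 : 1 ≤ Λ := by
    rw [hΛ, Real.le_log_iff_exp_le (by linarith)]
    have := Real.exp_one_lt_d9
    linarith
  have hexpΛ : Real.exp (-Λ) ≤ δ / 4 := by
    rw [Real.exp_neg, hΛ, Real.exp_log (by linarith), inv_div]
    gcongr
    nlinarith
  set a := √(2 * n * Λ) with ha
  have ha1 : 1 ≤ a := Real.one_le_sqrt.mpr (by nlinarith)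
  have hlog : 0 ≤ Real.log (n / δ) := Real.log_nonneg (by rw [le_div_iff₀ h0]; linarith)
  set rest := C₁ * V ^ (1 / (d + 2)) * (n : ℝ) ^ ((d + 1) / (d + 2))
        * Real.log (n / δ) ^ (1 / (d + 2))
    + C₂ * (n : ℝ) ^ ((2 * d + 1) / (2 * d + 4)) * Real.log (n / δ) with hrest
  have hrest0 : 0 ≤ rest := by positivity
  have hRB : VHCT.regretBound C₁ C₂ V d δ n = 2 * a + rest := by
    rw [VHCT.regretBound, hrest, ← add_assoc]
  have hRn : ∀ᵐ ω ∂μ, VHCT.regret (f xstar) r n ω ≤ n ∧ -n ≤ VHCT.regret (f xstar) r n ω := by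
    filter_upwards [ae_all_iff.mpr H.reward_mem] with ω hω
    have hmem : ∀ t ∈ Finset.Icc 1 n, r t ω ∈ Set.Icc (0 : ℝ) 1 := by
      intro t ht
      have := hω (t - 1)
      rwa [Nat.sub_add_cancel (Finset.mem_Icc.mp ht).1] at this
    have hfs := hf0 xstar
    constructor
    · calc VHCT.regret (f xstar) r n ω ≤ ∑ t ∈ Finset.Icc 1 n, (1 : ℝ) :=
            Finset.sum_le_sum fun t ht => by linarith [(hmem t ht).1, hfs.2]
        _ = n := by simp
    · calc -(n : ℝ) = ∑ t ∈ Finset.Icc 1 n, (-1 : ℝ) := by simp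
        _ ≤ VHCT.regret (f xstar) r n ω :=
            Finset.sum_le_sum fun t ht => by linarith [(hmem t ht).2, hfs.1]
  have hmeas : Measurable (VHCT.regret (f xstar) r n) := by
    refine Finset.measurable_fun_sum _ fun t ht => ?_
    have := (H.reward_meas (t - 1)).mono (ℱ.le _) le_rfl
    rw [Nat.sub_add_cancel (Finset.mem_Icc.mp ht).1] at this
    exact measurable_const.sub this
  -- Proved with a in place of 2a; the spare a ≥ 1 is kept for the expectation.
  have hprob : 1 - δ ≤ μ.real {ω | VHCT.regret (f xstar) r n ω ≤ a + rest} := by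
    have hs : MeasurableSet {ω | VHCT.regret (f xstar) r n ω ≤ a + rest} :=
      measurableSet_le hmeas measurable_const
    have hcompl : μ.real {ω | VHCT.regret (f xstar) r n ω ≤ a + rest}ᶜ ≤ δ := by
      have hsub : ({ω | VHCT.regret (f xstar) r n ω ≤ a + rest}ᶜ : Set Ω) ≤ᵐ[μ]
          ({ω | ¬ ∀ m < n, VHCT.Concentrated (fun v => f (P.arm v)) b δ ε V
            (fun t => p t ω) (fun t => r t ω) m} ∪
          {ω | a ≤ ∑ t ∈ Finset.range n, -VHCT.noise P f p r t ω} : Set Ω) := by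
        filter_upwards [hRn, H.isRun] with ω hω hrun hnot
        by_contra hcon
        refine hnot ?_
        show VHCT.regret (f xstar) r n ω ≤ a + rest
        -- For n = 1 the logarithm log(n/δ) may vanish, but the regret is at most 1 ≤ a.
        rcases Nat.lt_or_ge n 2 with h2 | h2
        · have : (n : ℝ) = 1 := by
            have : n = 1 := by omega
            rw [this]; norm_num
          linarith [hω.1]
        · have hcon1 : ∀ m < n, VHCT.Concentrated (fun v => f (P.arm v)) b δ ε V
              (fun t => p t ω) (fun t => r t ω) m := by
            by_contra hc
            exact hcon (Or.inl hc)
          have hcon2 : ∑ t ∈ Finset.range n, -VHCT.noise P f p r t ω < a := by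
            by_contra hc
            exact hcon (Or.inr (not_lt.mp hc))
          have := hbound hf0 hsm hdim hεV hVκ h0 h1 h2 hrun hcon1
          rw [VHCT.regret_eq P f (f xstar) p r n ω]
          linarith
      calc _ ≤ μ.real _ := ENNReal.toReal_mono (measure_ne_top _ _) (measure_mono_ae hsub)
        _ ≤ _ := measureReal_union_le _ _
        _ ≤ δ / 4 + δ / 4 := add_le_add (H.measure_exists_not_concentrated_le hb h0 h1 n)
            ((H.measure_sum_noise_le hf0 hn (by linarith)).trans hexpΛ)
        _ ≤ δ := by linarith
    rw [measureReal_compl hs, probReal_univ] at hcompl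
    linarith
  refine ⟨hprob.trans (measureReal_mono fun ω hω => ?_), fun hδ => ?_⟩
  · have h : VHCT.regret (f xstar) r n ω ≤ a + rest := hω
    show VHCT.regret (f xstar) r n ω ≤ _
    rw [hRB]; linarith
  · have hint : Integrable (VHCT.regret (f xstar) r n) μ := by
      refine Integrable.of_bound hmeas.aestronglyMeasurable n ?_
      filter_upwards [hRn] with ω hω
      exact abs_le.mpr ⟨hω.2, hω.1⟩
    refine ⟨hint, ?_⟩
    rw [← hδ, hRB]
    -- On the exceptional event the regret is at most n, which contributes nδ = 1 ≤ a.
    have h := VHCT.integral_le_of_measure_le hmeas hint (by linarith) (by linarith)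
      (hRn.mono fun ω hω => hω.1) hprob
    have : (n : ℝ) * δ = 1 := by rw [hδ]; field_simp
    linarith
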